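/- A (finite) ribbon graph $G=(V(G),E(G))$ is a surface with boundary that is the union of a finite set $V(G)$ of discs (vertices) and a finite set $E(G)$ of discs (edges) such that vertices and edges meet in disjoint line segments, each such segment lies on the boundary of exactly one vertex and exactly one edge, and every edge contains exactly two of them. Ribbon graphs are considered up to homeomorphisms that map vertices to vertices and edges to edges. A connected ribbon graph is called plane if its Euler genus is $0$, and $\mathbb{R}\mathrm{P}^2$ if its Euler genus is $1$, where the Euler genus is $2-\chi$ with $\chi$ the Euler characteristic of the closed surface obtained by gluing a disc to each boundary component. For $A\subseteq E(G)$, the partial dual $G^A$ is formed as follows. Orient the boundary of each edge disc of $G$. The boundary components of the spanning ribbon subgraph $(V(G),A)$ meet the edges of $G$ in disjoint arcs; on each of these arcs place an arrow, labelled by the edge and pointing along its boundary orientation. The vertices of $G^A$ are discs bounded by these marked boundary components, and for each $e\in E(G)$ an edge disc is glued to the two arrows labelled $e$, compatibly with their directions. Thus $G^{*}:=G^{E(G)}$ is the geometric dual of $G$. Ribbon graphs $G$ and $H$ are partial duals if $H=G^A$ for some $A\subseteq E(G)$. A connected ribbon graph $G$ is a join, $G=P\vee Q$, of connected ribbon subgraphs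 $P$ and $Q$, each having at least one edge, if $G=P\cup Q$, $P\cap Q$ is a single vertex $v$, and there is an arc on the boundary of $v$ that contains all the segments in which edges of $P$ meet $v$ and meets no edge of $Q$. In this case one says that $G^{E(Q)}=P\vee Q^{*}$ is obtained from $G$ by a dual-of-a-join-summand move. Two ribbon graphs $G$ and $H$ are related by dualling join-summands if there is a finite (possibly empty) sequence of dual-of-a-join-summand moves taking $G$ to $H$, or if $H=G^{*}$. **Theorem.** Let $G$ and $H$ be connected ribbon graphs. 1. If $G$ and $H$ are both plane, then they are partial duals of each other if and only if they are related by dualling join-summands. 2. If $G$ and $H$ are both $\mathbb{R}\mathrm{P}^2$, then they are partial duals of each other if and only if they are related by dualling join-summands. -/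

import Mathlib

universe u v

/-- The endpoints of the marking arrows of an arrow presentation with label set `E`. There are
exactly two arrows with each label `e`, numbered by a `Bool`; the tail of arrow `i` is
`(e, i, false)` and its head is `(e, i, true)`. Equivalently, these are the four corners of the
edge disc `e`, whose boundary, when oriented, runs along arrow `false` from tail to head,
along a side of the edge, along arrow `true` from tail to head, and back along the other side. -/
abbrev Corner (E : Type u) : Type u := E × Bool × Bool

namespace Corner

variable {E : Type u}

/-- The other endpoint of the same marking arrow: both bound the same line segment in which
the edge meets a vertex. -/
def acrossEnd (x : Corner E) : Corner E := (x.1, x.2.1, !x.2.2)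

/-- The other endpoint of the same side of the edge: the head of one arrow is joined by
a side of the edge disc to the tail of the other arrow with the same label. -/
def alongSide (x : Corner E) : Corner E := (x.1, !x.2.1, !x.2.2)

end Corner

/-- A ribbon graph with edge set `E`, described by an arrow presentation: a set of circles
(the boundaries of the vertex discs) marked with arrows, exactly two for each `e : E`.
The marking arrows cut the marked circles into arcs running between arrow endpoints;
`arc x` is the endpoint at the other end of the arc that starts at the arrow endpoint `x`.
The circles carrying no arrow (isolated vertices) are only counted.
The edge `e` is the disc glued to the two arrows labelled `e` in the direction of the arrows. -/
structure RibbonGraph (E : Type u) where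
  arc : Corner E → Corner E
  arc_arc : ∀ x, arc (arc x) = x
  arc_ne : ∀ x, arc x ≠ x
  isolated : ℕ

namespace RibbonGraph

open Corner

variable {E : Type u} {E' : Type v}

/-- Equivalence of ribbon graphs: a bijection of the corners preserving edge ends, edge sides and
the arcs of vertex boundaries (that is, a homeomorphism matching vertices with
vertices and edges with edges), and as many isolated vertices. On arrow presentations this amounts
to renaming the labels, exchanging the two arrows with a label, and reversing both of them. -/
def Equivalent (G : RibbonGraph E) (H : RibbonGraph E') : Prop :=
  G.isolated = H.isolated ∧
    ∃ φ : Corner E ≃ Corner E',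
      (∀ x, φ (acrossEnd x) = acrossEnd (φ x)) ∧
      (∀ x, φ (alongSide x) = alongSide (φ x)) ∧
      (∀ x, φ (G.arc x) = H.arc (φ x))

/-- The vertices: the marked circles (traced by alternating arrows and arcs) and
the isolated vertices. `Quot` divides by the equivalence relation generated. -/
def Vertex (G : RibbonGraph E) : Type u :=
  Quot (fun x y : Corner E => y = G.arc x ∨ y = acrossEnd x) ⊕ Fin G.isolated

/-- The boundary components of the ribbon graph, viewed as a surface: they are traced by alternating
sides of edges and arcs of vertex boundaries; an isolated vertex has one boundary component. -/
def BoundaryComponent (G : RibbonGraph E) : Type u :=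
  Quot (fun x y : Corner E => y = G.arc x ∨ y = alongSide x) ⊕ Fin G.isolated

/-- The vertex carrying the arrow endpoint `x`. -/
def vertexAt (G : RibbonGraph E) (x : Corner E) : G.Vertex := Sum.inl (Quot.mk _ x)

/-- The vertex that the end `i` of the edge `e` is attached to. -/
def endVertex (G : RibbonGraph E) (e : E) (i : Bool) : G.Vertex := G.vertexAt (e, i, false)

/-- A ribbon subgraph: what is left after deleting vertices and edges. -/
structure Subgraph (G : RibbonGraph E) where
  verts : Set G.Vertex
  edges : Set E
  endVertex_mem : ∀ e ∈ edges, ∀ i, G.endVertex e i ∈ verts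

/-- Two vertices are joined by an edge of the ribbon subgraph `P`. -/
def Subgraph.Adj {G : RibbonGraph E} (P : G.Subgraph) (a b : G.Vertex) : Prop :=
  ∃ e ∈ P.edges, ∃ i, a = G.endVertex e i ∧ b = G.endVertex e (!i)

/-- Connected (and hence non-empty) ribbon subgraphs. -/
def Subgraph.Connected {G : RibbonGraph E} (P : G.Subgraph) : Prop :=
  P.verts.Nonempty ∧ ∀ a ∈ P.verts, ∀ b ∈ P.verts, Relation.ReflTransGen P.Adj a b

/-- Non-trivial ribbon subgraphs have an edge; for a connected one this says that it is not
an isolated vertex. -/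
def Subgraph.Nontrivial {G : RibbonGraph E} (P : G.Subgraph) : Prop := P.edges.Nonempty

/-- `G` as a ribbon subgraph of itself. -/
def whole (G : RibbonGraph E) : G.Subgraph where
  verts := Set.univ
  edges := Set.univ
  endVertex_mem := fun _ _ _ => Set.mem_univ _

def Connected (G : RibbonGraph E) : Prop := G.whole.Connected

/-- The connected components. -/
def Component (G : RibbonGraph E) : Type u := Quot G.whole.Adj

/-- Euler characteristic of the closed surface obtained from `G` by capping off its boundary
components with discs (`G` finite). -/
noncomputable def eulerChar (G : RibbonGraph E) : ℤ :=
  (Nat.card G.Vertex : ℤ) - Nat.card E + Nat.card G.BoundaryComponent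

/-- Euler genus. On a connected closed surface it is twice the genus if the surface is orientable and
the genus otherwise, that is `2 - χ` in both cases; it is summed over the components. -/
noncomputable def eulerGenus (G : RibbonGraph E) : ℤ :=
  2 * (Nat.card G.Component : ℤ) - G.eulerChar

def IsPlane (G : RibbonGraph E) : Prop := G.Connected ∧ G.eulerGenus = 0

def IsRP2 (G : RibbonGraph E) : Prop := G.Connected ∧ G.eulerGenus = 1

/-- Positions of the new arrow endpoints when new arrows are drawn along the sides of the edges:
for each edge the new arrow `false` runs along the side from the tail of the old
arrow `false` to the head of the old arrow `true`, and the new arrow `true` along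
the side from the tail of the old arrow `true` to the head of the old arrow `false`. Both new arrows
follow one and the same orientation of the boundary of the edge disc. -/
def sideCorner (x : Corner E) : Corner E := (x.1, xor x.2.1 x.2.2, x.2.2)

theorem sideCorner_sideCorner (x : Corner E) : sideCorner (sideCorner x) = x := by
  obtain ⟨e, i, b⟩ := x
  simp [sideCorner]

open Classical in
/-- Positions of the arrow endpoints when the arrows of the edges in `A` are
drawn along the sides of these edges and the other arrows are left where they are. -/
noncomputable def partialCorner (A : Set E) (x : Corner E) : Corner E :=
  if x.1 ∈ A then sideCorner x else x

theorem partialCorner_partialCorner (A : Set E) (x : Corner E) :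
    partialCorner A (partialCorner A x) = x := by
  by_cases h : x.1 ∈ A
  · have h' : (sideCorner x).1 ∈ A := h
    rw [partialCorner, partialCorner, if_pos h, if_pos h', sideCorner_sideCorner]
  · rw [partialCorner, partialCorner, if_neg h, if_neg h]

/-- The partial dual `G ^ A`. The boundary components of the spanning ribbon subgraph `(V(G), A)`
meet an edge in `A` in its two sides and an edge not in `A` in its two ends. On each of these
segments an arrow is placed, following an orientation of the boundary of the edge; between them the
boundary components follow the arcs of the vertex boundaries of `G`. The marked
boundary components form the arrow presentation of `G ^ A`. -/
noncomputable def partialDual (G : RibbonGraph E) (A : Set E) : RibbonGraph E where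
  arc := fun x => partialCorner A (G.arc (partialCorner A x))
  arc_arc := fun x => by
    simp only [partialCorner_partialCorner, G.arc_arc]
  arc_ne := fun x h => G.arc_ne (partialCorner A x) (by
    have h' := congrArg (partialCorner A) h
    rwa [partialCorner_partialCorner] at h')
  isolated := G.isolated

/-- The geometric dual: the new vertices are discs filling the boundary components of `G`, the old
vertices are removed, and so every edge is now attached to vertices along its sides. -/
def dual (G : RibbonGraph E) : RibbonGraph E where
  arc := fun x => sideCorner (G.arc (sideCorner x))
  arc_arc := fun x => by
    simp only [sideCorner_sideCorner, G.arc_arc]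
  arc_ne := fun x h => G.arc_ne (sideCorner x) (by
    have h' := congrArg sideCorner h
    rwa [sideCorner_sideCorner] at h')
  isolated := G.isolated

/-- `G` is the `1`-sum of its ribbon subgraphs `P` and `Q`, occurring at the vertex `w`. -/
structure IsOneSum (G : RibbonGraph E) (P Q : G.Subgraph) (w : G.Vertex) : Prop where
  connected : G.Connected
  connected_left : P.Connected
  connected_right : Q.Connected
  nontrivial_left : P.Nontrivial
  nontrivial_right : Q.Nontrivial
  verts_union : P.verts ∪ Q.verts = Set.univ
  edges_union : P.edges ∪ Q.edges = Set.univ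
  verts_inter : P.verts ∩ Q.verts = {w}
  edges_inter : P.edges ∩ Q.edges = ∅

/-- Walking along the boundary of a vertex: traverse the arrow that `x` is an endpoint of, starting
from `x`, and then the arc that follows, up to the first endpoint of the next arrow. -/
def next (G : RibbonGraph E) (x : Corner E) : Corner E := G.arc (acrossEnd x)

/-- The arc of a vertex boundary that starts at `x` and runs through `n` successive edge ends (in the
direction in which the arrow at `x` is traversed from `x`) contains the end `i` of `e`. -/
def OnArc (G : RibbonGraph E) (x : Corner E) (n : ℕ) (e : E) (i : Bool) : Prop :=
  ∃ k < n, ∃ b, G.next^[k] x = (e, i, b)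

/-- `G = P ∨ Q`: a `1`-sum, occurring at `w` say, such that some arc of the boundary
of `w` contains all the ends of edges of `P` at `w` and no end of an edge of `Q`. -/
def IsJoin (G : RibbonGraph E) (P Q : G.Subgraph) : Prop :=
  ∃ w, G.IsOneSum P Q w ∧
    ∃ x n, G.vertexAt x = w ∧
      (∀ e ∈ P.edges, ∀ i, G.endVertex e i = w → G.OnArc x n e i) ∧
      (∀ e ∈ Q.edges, ∀ i, ¬ G.OnArc x n e i)

/-- `G` and `H` are partial duals: `H = G ^ A` for some set `A` of edges. -/
def ArePartialDuals (G : RibbonGraph E) (H : RibbonGraph E') : Prop :=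
  ∃ A : Set E, (G.partialDual A).Equivalent H

/-- The dual-of-a-join-summand move, from `G = P ∨ Q` to `G ^ E(Q) = P ∨ Q^*`. -/
def DualJoinSummandMove (G K : RibbonGraph E) : Prop :=
  ∃ P Q : G.Subgraph, G.IsJoin P Q ∧ (G.partialDual Q.edges).Equivalent K

/-- Related by dualling join-summands: a (possibly empty) finite sequence of
dual-of-a-join-summand moves leads from `G` to `H`, or `G` and `H` are geometric duals. -/
def RelatedByDualling (G : RibbonGraph E) (H : RibbonGraph E') : Prop :=
  (∃ K : RibbonGraph E, Relation.ReflTransGen DualJoinSummandMove G K ∧ K.Equivalent H) ∨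
    G.dual.Equivalent H

end RibbonGraph

/-! Take the corners as flags, with the involutions `arc`, `side` and `tip`, and let n be the number
of edges. Over `ZMod 2`, the functions constant along a fixed-point-free involution form a
Lagrangian subspace for the dot product, and the dimension of the intersection of two such subspaces
counts orbits. Vertices of `G ^ A` are orbits of `arc` together with the involution that is `side`
on `A` and `tip` off `A`; boundary components arise likewise from `Aᶜ`. In the absence of isolated
vertices, a connected `G ^ A` of Euler genus γ therefore satisfies `orbitRank A + orbitRank Aᶜ = n +
(2 - γ)`.

That related graphs are partial duals is formal: every move is a partial dual, and partial duals
compose by symmetric difference.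

For the converse let `H = G ^ A`, with `A` neither empty nor everything. An arc is mixed if it joins
an edge of `A` to an edge outside `A`. Let m be the number of mixed arcs and b the number of pieces
left after cutting them. Gluing the two halves along the Lagrangian traces they leave on the mixed
arcs gives an upper bound for the orbit counts (`FlagSystem.orbitRank_inequality`). In the plane
case it yields m ≤ 2b - 2. In the projective case it yields only m ≤ 2b, so it is applied to the
orientation double cover instead; this cover is connected, since an odd Euler characteristic
excludes orientability (`FlagSystem.even_of_colouring`). Hence m < 2b in both cases.

The 2m ends of mixed arcs are shared by b pieces, so some piece Q has fewer than four; by parity and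
connectedness it has exactly two. Then Q and its complement form a join
(`isJoin_of_card_mixed_eq_two`), dualling Q preserves the Euler genus, and the symmetric difference
of Q and `A`, which remains to be dualized, has fewer mixed arcs. Induction on m finishes the proof.
-/

open Module

/-! ### Functions modulo 2 invariant under an involution -/

/-- The submodule of functions `X → ZMod 2` that are constant along `σ`. -/
def invFun {X : Type*} (σ : X → X) : Submodule (ZMod 2) (X → ZMod 2) where
  carrier := {f | ∀ x, f (σ x) = f x}
  add_mem' := fun hf hg x => by simp only [Pi.add_apply, hf x, hg x]
  zero_mem' := fun _ => rfl
  smul_mem' := fun c f hf x => by simp only [Pi.smul_apply, hf x]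

@[simp] theorem mem_invFun {X : Type*} {σ : X → X} {f : X → ZMod 2} :
    f ∈ invFun σ ↔ ∀ x, f (σ x) = f x := Iff.rfl

theorem finrank_map_add_finrank_inf_ker {V W : Type*} [AddCommGroup V] [Module (ZMod 2) V]
    [AddCommGroup W] [Module (ZMod 2) W] [Finite V] (U : Submodule (ZMod 2) V)
    (r : V →ₗ[ZMod 2] W) :
    finrank (ZMod 2) (U.map r) + finrank (ZMod 2) ↥(U ⊓ LinearMap.ker r) =
      finrank (ZMod 2) U := by
  have h := LinearMap.finrank_range_add_finrank_ker (r.domRestrict U)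
  rw [LinearMap.range_domRestrict] at h
  have h2 : finrank (ZMod 2) (LinearMap.ker (r.domRestrict U)) =
      finrank (ZMod 2) ↥(U ⊓ LinearMap.ker r) := by
    rw [LinearMap.ker_domRestrict, ← Submodule.finrank_map_subtype_eq U
      (Submodule.comap U.subtype (LinearMap.ker r)), Submodule.map_comap_subtype]
  omega

/-- The linear map `f ↦ f + f ∘ σ`. -/
def addComp {X : Type*} (σ : X → X) : (X → ZMod 2) →ₗ[ZMod 2] (X → ZMod 2) :=
  LinearMap.id + LinearMap.funLeft (ZMod 2) (ZMod 2) σ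

@[simp] theorem addComp_apply {X : Type*} (σ : X → X) (f : X → ZMod 2) (x : X) :
    addComp σ f x = f x + f (σ x) := rfl

theorem ker_addComp {X : Type*} (σ : X → X) : LinearMap.ker (addComp σ) = invFun σ := by
  ext f
  rw [LinearMap.mem_ker, mem_invFun, funext_iff]
  refine forall_congr' fun x => ?_
  rw [addComp_apply, Pi.zero_apply, CharTwo.add_eq_zero, eq_comm]

theorem addComp_mem_invFun {X : Type*} {σ : X → X} (h : Function.Involutive σ) (f : X → ZMod 2) :
    addComp σ f ∈ invFun σ := fun x => by
  simp only [addComp_apply, h x, add_comm]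

/-! ### Lagrangian subspaces for the dot product -/

section Orthogonal

variable {X : Type*} [Fintype X]

/-- The orthogonal complement for the dot product. -/
def orth (U : Submodule (ZMod 2) (X → ZMod 2)) : Submodule (ZMod 2) (X → ZMod 2) where
  carrier := {g | ∀ f ∈ U, f ⬝ᵥ g = 0}
  add_mem' := fun hf hg f h => by rw [dotProduct_add, hf f h, hg f h, add_zero]
  zero_mem' := fun f _ => dotProduct_zero f
  smul_mem' := fun c f hf g h => by rw [dotProduct_smul, hf g h, smul_zero]

theorem mem_orth {U : Submodule (ZMod 2) (X → ZMod 2)} {g : X → ZMod 2} :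
    g ∈ orth U ↔ ∀ f ∈ U, f ⬝ᵥ g = 0 := Iff.rfl

theorem finrank_add_finrank_orth (U : Submodule (ZMod 2) (X → ZMod 2)) :
    finrank (ZMod 2) U + finrank (ZMod 2) (orth U) = Fintype.card X := by
  classical
  have h := Subspace.finrank_add_finrank_dualAnnihilator_eq (K := ZMod 2) U
  have h2 : orth U = U.dualAnnihilator.comap
      (dotProductEquiv (ZMod 2) X : (X → ZMod 2) →ₗ[ZMod 2] Dual (ZMod 2) (X → ZMod 2)) := by
    ext g
    simp only [mem_orth, Submodule.mem_comap, Submodule.mem_dualAnnihilator]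
    refine forall₂_congr fun f _ => ?_
    rw [dotProduct_comm]
    rfl
  have h3 : finrank (ZMod 2) (orth U) = finrank (ZMod 2) U.dualAnnihilator := by
    rw [h2, Submodule.comap_equiv_eq_map_symm]
    exact LinearEquiv.finrank_map_eq _ _
  rw [h3, h, finrank_fintype_fun_eq_card]

theorem finrank_add_le_card {U W : Submodule (ZMod 2) (X → ZMod 2)}
    (h : ∀ f ∈ U, ∀ g ∈ W, f ⬝ᵥ g = 0) :
    finrank (ZMod 2) U + finrank (ZMod 2) W ≤ Fintype.card X := by
  rw [← finrank_add_finrank_orth U]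
  exact Nat.add_le_add_left (Submodule.finrank_mono (show W ≤ orth U from fun g hg f hf => h f hf g hg)) _

/-- Lagrangian subspaces for the dot product. -/
structure IsLagrangian (L : Submodule (ZMod 2) (X → ZMod 2)) : Prop where
  isotropic : ∀ f ∈ L, ∀ g ∈ L, f ⬝ᵥ g = 0
  finrank_eq : 2 * finrank (ZMod 2) L = Fintype.card X

theorem isLagrangian_of_le {L : Submodule (ZMod 2) (X → ZMod 2)}
    (h : ∀ f ∈ L, ∀ g ∈ L, f ⬝ᵥ g = 0) (h2 : Fintype.card X ≤ 2 * finrank (ZMod 2) L) :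
    IsLagrangian L :=
  ⟨h, by have := finrank_add_le_card h; omega⟩

theorem IsLagrangian.orth_eq {L : Submodule (ZMod 2) (X → ZMod 2)} (h : IsLagrangian L) :
    orth L = L := by
  symm
  apply Submodule.eq_of_le_of_finrank_eq (show L ≤ orth L from fun g hg f hf =>
    h.isotropic f hf g hg)
  have := finrank_add_finrank_orth L
  have := h.finrank_eq
  omega

theorem IsLagrangian.mem_of_forall {L : Submodule (ZMod 2) (X → ZMod 2)} (h : IsLagrangian L)
    {g : X → ZMod 2} (hg : ∀ f ∈ L, f ⬝ᵥ g = 0) : g ∈ L := by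
  rw [← h.orth_eq]
  exact hg

variable {a b c d : Submodule (ZMod 2) (X → ZMod 2)}

/-- The complement of `a ⊔ b ⊔ c` lies in the triple intersection, and `(a ⊓ c) ⊔ (b ⊓ c)` lies in
`(a ⊔ b) ⊓ c`; the rest is a dimension count. For the three involutions of a closed surface this is
the bound χ ≤ 2 · (number of components). -/
theorem IsLagrangian.three (ha : IsLagrangian a) (hb : IsLagrangian b) (hc : IsLagrangian c) :
    2 * (finrank (ZMod 2) ↥(a ⊓ b) + finrank (ZMod 2) ↥(b ⊓ c) + finrank (ZMod 2) ↥(a ⊓ c)) ≤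
      Fintype.card X + 4 * finrank (ZMod 2) ↥(a ⊓ b ⊓ c) := by
  have h1 := Submodule.finrank_sup_add_finrank_inf_eq a b
  have h2 := Submodule.finrank_sup_add_finrank_inf_eq (a ⊔ b) c
  have h3 := Submodule.finrank_sup_add_finrank_inf_eq (a ⊓ c) (b ⊓ c)
  have h4 : a ⊓ c ⊓ (b ⊓ c) = a ⊓ b ⊓ c := by
    rw [← inf_inf_distrib_right]
  have h5 : finrank (ZMod 2) ↥(a ⊓ c ⊔ b ⊓ c) ≤ finrank (ZMod 2) ↥((a ⊔ b) ⊓ c) :=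
    Submodule.finrank_mono (sup_le (inf_le_inf_right c le_sup_left)
      (inf_le_inf_right c le_sup_right))
  have h6 := finrank_add_finrank_orth (a ⊔ b ⊔ c)
  have h7 : finrank (ZMod 2) (orth (a ⊔ b ⊔ c)) ≤ finrank (ZMod 2) ↥(a ⊓ b ⊓ c) := by
    refine Submodule.finrank_mono fun g hg => ⟨⟨ha.mem_of_forall fun f hf => hg f ?_,
      hb.mem_of_forall fun f hf => hg f ?_⟩, hc.mem_of_forall fun f hf => hg f ?_⟩
    · exact Submodule.mem_sup_left (Submodule.mem_sup_left hf)
    · exact Submodule.mem_sup_left (Submodule.mem_sup_right hf)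
    · exact Submodule.mem_sup_right hf
  rw [h4] at h3
  have := ha.finrank_eq
  have := hb.finrank_eq
  have := hc.finrank_eq
  omega

/-- Add `three` for `a, b, c` and for `a, b, d`. The two triple intersections lie in `a ⊓ b` and
meet in the fourfold one, so the terms in `a ⊓ b` cancel. -/
theorem IsLagrangian.four (ha : IsLagrangian a) (hb : IsLagrangian b) (hc : IsLagrangian c)
    (hd : IsLagrangian d) :
    finrank (ZMod 2) ↥(a ⊓ c) + finrank (ZMod 2) ↥(b ⊓ d) + finrank (ZMod 2) ↥(a ⊓ d) +
      finrank (ZMod 2) ↥(b ⊓ c) ≤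
      Fintype.card X + 2 * finrank (ZMod 2) ↥(a ⊓ b ⊓ (c ⊓ d)) := by
  have h1 := ha.three hb hc
  have h2 := ha.three hb hd
  have h3 := Submodule.finrank_sup_add_finrank_inf_eq (a ⊓ b ⊓ c) (a ⊓ b ⊓ d)
  have h4 : a ⊓ b ⊓ c ⊓ (a ⊓ b ⊓ d) = a ⊓ b ⊓ (c ⊓ d) := by
    rw [← inf_inf_distrib_left]
  have h5 : finrank (ZMod 2) ↥(a ⊓ b ⊓ c ⊔ a ⊓ b ⊓ d) ≤ finrank (ZMod 2) ↥(a ⊓ b) :=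
    Submodule.finrank_mono (sup_le inf_le_left inf_le_left)
  rw [h4] at h3
  omega

theorem zmod2_add_self (x : ZMod 2) : x + x = 0 := CharTwo.add_self_eq_zero x

/-- Pairing off the points not fixed by an involution. -/
theorem sum_eq_sum_fixed {M : Type*} [Fintype M] {β : X → X} (hβ : Function.Involutive β)
    {ι : M → X} (hι : Function.Injective ι) (hfix : ∀ x, β x = x ↔ x ∈ Set.range ι)
    {f : X → ZMod 2} (hf : ∀ x, f (β x) = f x) : ∑ x, f x = ∑ m, f (ι m) := by
  classical
  have h1 : ∑ x ∈ Finset.univ.filter (fun x => ¬ β x = x), f x = 0 := by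
    refine Finset.sum_involution (fun x _ => β x) (fun x _ => ?_) (fun x hx _ => ?_)
      (fun x hx => ?_) (fun x _ => hβ x)
    · rw [hf, zmod2_add_self]
    · simpa using hx
    · simp only [Finset.mem_filter, Finset.mem_univ, true_and] at hx ⊢
      rw [hβ x]
      exact fun h => hx h.symm
  rw [← Finset.sum_filter_add_sum_filter_not Finset.univ (fun x => β x = x), h1, add_zero]
  symm
  refine Finset.sum_bij (fun m _ => ι m) (fun m _ => ?_) (fun _ _ _ _ h => hι h) (fun x hx => ?_)
    (fun _ _ => rfl)
  · simpa using (hfix (ι m)).2 ⟨m, rfl⟩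
  · obtain ⟨m, hm⟩ := (hfix x).1 (by simpa using hx)
    exact ⟨m, Finset.mem_univ _, hm⟩

theorem sum_eq_zero_of_involutive {β : X → X} (hβ : Function.Involutive β)
    (hfix : ∀ x, β x ≠ x) {f : X → ZMod 2} (hf : ∀ x, f (β x) = f x) : ∑ x, f x = 0 := by
  rw [sum_eq_sum_fixed hβ (ι := (Empty.elim : Empty → X)) (fun e => e.elim)
    (fun x => ⟨fun h => (hfix x h).elim, fun ⟨e, _⟩ => e.elim⟩) hf]
  simp

/-- Products of invariant functions cancel in pairs. The map `f ↦ f + f ∘ σ` has the invariant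
functions as kernel and takes values among them, so they fill at least half of the space. -/
theorem isLagrangian_invFun {σ : X → X} (h : Function.Involutive σ) (hσ : ∀ x, σ x ≠ x) :
    IsLagrangian (invFun σ) := by
  apply isLagrangian_of_le
  · intro f hf g hg
    exact sum_eq_zero_of_involutive h hσ (f := fun x => f x * g x) fun x => by rw [hf x, hg x]
  · have h1 := LinearMap.finrank_range_add_finrank_ker (addComp σ)
    rw [ker_addComp, finrank_fintype_fun_eq_card] at h1
    have h2 : finrank (ZMod 2) (LinearMap.range (addComp σ)) ≤ finrank (ZMod 2) (invFun σ) := by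
      apply Submodule.finrank_mono
      rintro _ ⟨f, rfl⟩
      exact addComp_mem_invFun h f
    omega

theorem card_le_four_mul_finrank {s t : X → X} (hs : Function.Involutive s)
    (ht : Function.Involutive t) (hs0 : ∀ x, s x ≠ x) (hst : ∀ x, s (t x) = t (s x)) :
    Fintype.card X ≤ 4 * finrank (ZMod 2) ↥(invFun s ⊓ invFun t) := by
  have h1 := finrank_map_add_finrank_inf_ker (invFun s) (addComp t)
  rw [ker_addComp] at h1
  have h2 : finrank (ZMod 2) ((invFun s).map (addComp t)) ≤
      finrank (ZMod 2) ↥(invFun s ⊓ invFun t) := by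
    apply Submodule.finrank_mono
    rintro _ ⟨f, hf, rfl⟩
    refine ⟨fun x => ?_, addComp_mem_invFun ht f⟩
    rw [addComp_apply, addComp_apply, ← hst, hf x, hf (t x)]
  have h3 := (isLagrangian_invFun hs hs0).finrank_eq
  omega

/-- Since y² = y in `ZMod 2`, isotropic vectors are orthogonal to the constant 1. In a plane only
one line can then be Lagrangian. -/
theorem IsLagrangian.finrank_inf_of_card_eq_two (ha : IsLagrangian a) (hb : IsLagrangian b)
    (h : Fintype.card X = 2) : finrank (ZMod 2) ↥(a ⊓ b) = 1 := by
  have key : ∀ L : Submodule (ZMod 2) (X → ZMod 2), IsLagrangian L → ∀ f ∈ L, ∑ x, f x = 0 := by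
    intro L hL f hf
    rw [← hL.isotropic f hf f hf]
    refine Finset.sum_congr rfl fun x _ => ?_
    generalize f x = y
    revert y
    decide
  have h1 := Submodule.finrank_sup_add_finrank_inf_eq a b
  have := ha.finrank_eq
  have := hb.finrank_eq
  have h2 := finrank_add_finrank_orth (a ⊔ b)
  obtain ⟨x⟩ : Nonempty X := Fintype.card_pos_iff.1 (by omega)
  have h3 : 1 ≤ finrank (ZMod 2) (orth (a ⊔ b)) := by
    rw [Nat.one_le_iff_ne_zero, Ne, Submodule.finrank_eq_zero]
    intro h0
    have : (fun _ => 1 : X → ZMod 2) ∈ orth (a ⊔ b) := by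
      intro f hf
      obtain ⟨g, hg, k, hk, rfl⟩ := Submodule.mem_sup.1 hf
      rw [add_dotProduct]
      simp [dotProduct, key a ha g hg, key b hb k hk]
    rw [h0, Submodule.mem_bot] at this
    exact one_ne_zero (congrFun this x)
  have h4 : finrank (ZMod 2) a ≤ finrank (ZMod 2) ↥(a ⊔ b) := Submodule.finrank_mono le_sup_left
  omega

end Orthogonal

/-! ### Reduction to the fixed points of an involution -/

section Half

variable {X M : Type*} [Fintype X] {β : X → X} {ι : M → X}

/-- The traces on `M` of the functions in `L` that are constant along `β`. -/
def trace (β : X → X) (ι : M → X) (L : Submodule (ZMod 2) (X → ZMod 2)) :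
    Submodule (ZMod 2) (M → ZMod 2) :=
  (L ⊓ invFun β).map (LinearMap.funLeft (ZMod 2) (ZMod 2) ι)

/-- The functions in `L` that are constant along `β` and have trace zero. -/
def traceKer (β : X → X) (ι : M → X) (L : Submodule (ZMod 2) (X → ZMod 2)) :
    Submodule (ZMod 2) (X → ZMod 2) :=
  L ⊓ invFun β ⊓ LinearMap.ker (LinearMap.funLeft (ZMod 2) (ZMod 2) ι)

theorem finrank_trace_add (L : Submodule (ZMod 2) (X → ZMod 2)) :
    finrank (ZMod 2) (trace β ι L) + finrank (ZMod 2) (traceKer β ι L) =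
      finrank (ZMod 2) ↥(L ⊓ invFun β) :=
  finrank_map_add_finrank_inf_ker _ _

variable [Fintype M] (hβ : Function.Involutive β) (hι : Function.Injective ι)
  (hfix : ∀ x, β x = x ↔ x ∈ Set.range ι)

include hβ hι hfix

theorem dotProduct_eq_trace {f g : X → ZMod 2} (hf : f ∈ invFun β) (hg : g ∈ invFun β) :
    f ⬝ᵥ g = (f ∘ ι) ⬝ᵥ (g ∘ ι) :=
  sum_eq_sum_fixed hβ hι hfix (f := fun x => f x * g x) fun x => by rw [hf x, hg x]

theorem finrank_traceKer_top :
    finrank (ZMod 2) (traceKer β ι ⊤) + Fintype.card M = finrank (ZMod 2) (invFun β) := by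
  classical
  have h := finrank_trace_add (β := β) (ι := ι) ⊤
  rw [top_inf_eq] at h
  have h2 : trace β ι ⊤ = ⊤ := by
    rw [eq_top_iff]
    intro φ _
    -- Extension by zero off the fixed points is invariant, because `β` preserves their complement.
    refine ⟨fun x => if hx : ∃ m, ι m = x then φ hx.choose else 0, ⟨trivial, fun x => ?_⟩, ?_⟩
    · by_cases hx : ∃ m, ι m = x
      · rw [(hfix x).2 hx]
      · have hx' : ¬ ∃ m, ι m = β x := fun h => hx (by
          have h1 := (hfix (β x)).2 h
          rw [hβ x] at h1
          rwa [← h1] at h)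
        simp only [hx, hx', dif_neg, not_false_eq_true]
    · funext m
      have hm : ∃ m', ι m' = ι m := ⟨m, rfl⟩
      simp only [LinearMap.funLeft_apply, hm, dif_pos]
      exact congrArg φ (hι hm.choose_spec)
  rw [h2, finrank_top, finrank_fintype_fun_eq_card] at h
  omega

theorem card_add_card_le_finrank :
    Fintype.card X + Fintype.card M ≤ 2 * finrank (ZMod 2) (invFun β) := by
  have h1 := LinearMap.finrank_range_add_finrank_ker (addComp β)
  rw [ker_addComp, finrank_fintype_fun_eq_card] at h1
  have h2 : finrank (ZMod 2) (LinearMap.range (addComp β)) ≤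
      finrank (ZMod 2) (traceKer β ι ⊤) := by
    apply Submodule.finrank_mono
    rintro _ ⟨f, rfl⟩
    refine ⟨⟨trivial, addComp_mem_invFun hβ f⟩, ?_⟩
    refine LinearMap.mem_ker.2 ?_
    funext m
    rw [LinearMap.funLeft_apply, addComp_apply, (hfix (ι m)).2 ⟨m, rfl⟩, zmod2_add_self,
      Pi.zero_apply]
  have := finrank_traceKer_top hβ hι hfix
  omega

/-- Symplectic reduction: on invariant functions the pairing sees only the fixed points, so traces
stay isotropic. The dimension is large enough because `traceKer` is orthogonal to `L ⊔ invFun β`. -/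
theorem isLagrangian_trace {L : Submodule (ZMod 2) (X → ZMod 2)} (hL : IsLagrangian L) :
    IsLagrangian (trace β ι L) := by
  apply isLagrangian_of_le
  · rintro _ ⟨f, hf, rfl⟩ _ ⟨g, hg, rfl⟩
    exact (dotProduct_eq_trace hβ hι hfix hf.2 hg.2).symm.trans (hL.isotropic f hf.1 g hg.1)
  · have h1 := finrank_trace_add (β := β) (ι := ι) L
    have h2 := Submodule.finrank_sup_add_finrank_inf_eq L (invFun β)
    have h3 := card_add_card_le_finrank hβ hι hfix
    have h4 : finrank (ZMod 2) ↥(L ⊔ invFun β) + finrank (ZMod 2) (traceKer β ι L) ≤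
        Fintype.card X := by
      apply finrank_add_le_card
      intro f hf g hg
      obtain ⟨f₁, hf₁, f₂, hf₂, rfl⟩ := Submodule.mem_sup.1 hf
      have hg0 : g ∘ ι = 0 := hg.2
      rw [add_dotProduct, hL.isotropic f₁ hf₁ g hg.1.1, dotProduct_eq_trace hβ hι hfix hf₂ hg.1.2,
        hg0, dotProduct_zero, add_zero]
    have := hL.finrank_eq
    omega

/-- Close up the open ends with the trace of `L₁`: the invariant functions with trace in `trace β ι
L₁` form a Lagrangian `L`, and `three` applies to `L, L₁, L₂`. Here `L ⊓ L₁` contains all invariant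
elements of `L₁`, and the traces of `L ⊓ L₂` cover the common traces of `L₁` and `L₂`. -/
theorem traceKer_inequality {L₁ L₂ : Submodule (ZMod 2) (X → ZMod 2)} (h₁ : IsLagrangian L₁)
    (h₂ : IsLagrangian L₂) :
    2 * finrank (ZMod 2) (traceKer β ι L₁) + 2 * finrank (ZMod 2) (traceKer β ι L₂) +
      Fintype.card M + 2 * finrank (ZMod 2) ↥(trace β ι L₁ ⊓ trace β ι L₂) +
      2 * finrank (ZMod 2) ↥(L₁ ⊓ L₂) ≤
      Fintype.card X + 4 * finrank (ZMod 2) ↥(L₁ ⊓ L₂ ⊓ invFun β) := by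
  set res := LinearMap.funLeft (ZMod 2) (ZMod 2) ι with hres
  set P₁ := trace β ι L₁ with hP₁
  have hP : IsLagrangian P₁ := isLagrangian_trace hβ hι hfix h₁
  set L := invFun β ⊓ P₁.comap res with hL
  have hker : ∀ f ∈ traceKer β ι ⊤, f ∈ L := fun f hf => ⟨hf.1.2, by
    refine Submodule.mem_comap.2 ?_
    rw [show res f = 0 from hf.2]
    exact zero_mem _⟩
  have hmapL : L.map res = P₁ := by
    apply le_antisymm
    · rintro _ ⟨f, hf, rfl⟩
      exact hf.2
    · rintro _ ⟨f, hf, rfl⟩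
      exact ⟨f, ⟨hf.2, f, hf, rfl⟩, rfl⟩
  have hLag : IsLagrangian L := by
    apply isLagrangian_of_le
    · intro f hf g hg
      rw [dotProduct_eq_trace hβ hι hfix hf.1 hg.1]
      exact hP.isotropic _ hf.2 _ hg.2
    · have a1 := finrank_map_add_finrank_inf_ker L res
      rw [hmapL] at a1
      have a2 : finrank (ZMod 2) (traceKer β ι ⊤) ≤ finrank (ZMod 2) ↥(L ⊓ LinearMap.ker res) :=
        Submodule.finrank_mono fun f hf => ⟨hker f hf, hf.2⟩
      have := finrank_traceKer_top hβ hι hfix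
      have := card_add_card_le_finrank hβ hι hfix
      have := hP.finrank_eq
      omega
  have key := hLag.three h₁ h₂
  have b1 : finrank (ZMod 2) ↥(L₁ ⊓ invFun β) ≤ finrank (ZMod 2) ↥(L ⊓ L₁) :=
    Submodule.finrank_mono fun f hf => ⟨⟨hf.2, f, hf, rfl⟩, hf.1⟩
  have b2 : finrank (ZMod 2) ↥(P₁ ⊓ trace β ι L₂) + finrank (ZMod 2) (traceKer β ι L₂) ≤
      finrank (ZMod 2) ↥(L ⊓ L₂) := by
    rw [← finrank_map_add_finrank_inf_ker (L ⊓ L₂) res]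
    refine Nat.add_le_add (Submodule.finrank_mono ?_) (Submodule.finrank_mono ?_)
    · rintro _ ⟨hf, f, hf2, rfl⟩
      exact ⟨f, ⟨⟨hf2.2, hf⟩, hf2.1⟩, rfl⟩
    · exact fun f hf => ⟨⟨hker f ⟨⟨trivial, hf.1.2⟩, hf.2⟩, hf.1.1⟩, hf.2⟩
  have b3 : finrank (ZMod 2) ↥(L ⊓ L₁ ⊓ L₂) ≤ finrank (ZMod 2) ↥(L₁ ⊓ L₂ ⊓ invFun β) :=
    Submodule.finrank_mono fun f hf => ⟨⟨hf.1.2, hf.2⟩, hf.1.1.1⟩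
  have : finrank (ZMod 2) P₁ + _ = _ := finrank_trace_add (β := β) (ι := ι) L₁
  have := hP.finrank_eq
  omega

end Half

/-! ### Dimensions of spaces of glued functions -/

section Glue

theorem finrank_submodule_prod {V W : Type*} [AddCommGroup V] [Module (ZMod 2) V]
    [AddCommGroup W] [Module (ZMod 2) W] [Finite V] [Finite W]
    (U₁ : Submodule (ZMod 2) V) (U₂ : Submodule (ZMod 2) W) :
    finrank (ZMod 2) (U₁.prod U₂) = finrank (ZMod 2) U₁ + finrank (ZMod 2) U₂ := by
  rw [← finrank_prod]
  exact LinearEquiv.finrank_eq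
    { toFun := fun x => (⟨x.1.1, x.2.1⟩, ⟨x.1.2, x.2.2⟩)
      invFun := fun x => ⟨(x.1, x.2), x.1.2, x.2.2⟩
      map_add' := fun _ _ => rfl
      map_smul' := fun _ _ => rfl
      left_inv := fun _ => rfl
      right_inv := fun _ => rfl }

/-- In characteristic 2 the kernel of the coproduct consists of the pairs with equal images, that
is, of data that can be glued. -/
theorem finrank_prod_inf_ker_coprod {V W N : Type*} [AddCommGroup V] [Module (ZMod 2) V]
    [AddCommGroup W] [Module (ZMod 2) W] [AddCommGroup N] [Module (ZMod 2) N] [Finite V] [Finite W]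
    (U₁ : Submodule (ZMod 2) V) (U₂ : Submodule (ZMod 2) W)
    (r₁ : V →ₗ[ZMod 2] N) (r₂ : W →ₗ[ZMod 2] N) :
    finrank (ZMod 2) ↥(U₁.map r₁ ⊔ U₂.map r₂) +
      finrank (ZMod 2) ↥(U₁.prod U₂ ⊓ LinearMap.ker (r₁.coprod r₂)) =
      finrank (ZMod 2) U₁ + finrank (ZMod 2) U₂ := by
  rw [← LinearMap.map_coprod_prod, finrank_map_add_finrank_inf_ker, finrank_submodule_prod]

variable {X : Type*} (A : Set X)

/-- A function is the same as a pair of functions on a set and on its complement. -/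
noncomputable def splitEquiv :
    (X → ZMod 2) ≃ₗ[ZMod 2] ({x // x ∈ A} → ZMod 2) × ({x // x ∈ Aᶜ} → ZMod 2) := by
  classical
  exact (LinearEquiv.funCongrLeft (ZMod 2) (ZMod 2) (Equiv.sumCompl (· ∈ A))).trans
    (LinearEquiv.sumArrowLequivProdArrow _ _ _ _)

theorem splitEquiv_apply (f : X → ZMod 2) :
    splitEquiv A f = (fun x => f x.1, fun x => f x.1) := rfl

theorem finrank_eq_of_split [Finite X] {U : Submodule (ZMod 2) (X → ZMod 2)}
    {W : Submodule (ZMod 2) (({x // x ∈ A} → ZMod 2) × ({x // x ∈ Aᶜ} → ZMod 2))}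
    (h : ∀ f, f ∈ U ↔ ((fun x => f x.1, fun x => f x.1) :
      ({x // x ∈ A} → ZMod 2) × ({x // x ∈ Aᶜ} → ZMod 2)) ∈ W) :
    finrank (ZMod 2) U = finrank (ZMod 2) W := by
  rw [← (splitEquiv A).finrank_map_eq U]
  congr 2
  all_goals
    have : U.map ((splitEquiv A : (X → ZMod 2) →ₗ[ZMod 2] _)) = W := by
      ext p
      obtain ⟨f, rfl⟩ := (splitEquiv A).surjective p
      rw [splitEquiv_apply, ← h f]
      exact ⟨fun ⟨g, hg, he⟩ => (splitEquiv A).injective he ▸ hg, fun hf => ⟨f, hf, rfl⟩⟩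
    rw [← this]

end Glue

/-! ### Flag systems and cutting along mixed arcs -/

/-- Flags of a closed cell decomposition: three fixed point free involutions,
two of which commute. -/
structure FlagSystem (X : Type*) where
  arc : X → X
  side : X → X
  tip : X → X
  arc_invol : Function.Involutive arc
  side_invol : Function.Involutive side
  tip_invol : Function.Involutive tip
  arc_ne : ∀ x, arc x ≠ x
  side_ne : ∀ x, side x ≠ x
  tip_ne : ∀ x, tip x ≠ x
  comm : ∀ x, side (tip x) = tip (side x)

section HalfArc

variable {X : Type*}

open Classical in
/-- The restriction of `α` to `A`, modified to fix the points that `α` moves out of `A`. -/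
noncomputable def halfArc (α : X → X) (A : Set X) (x : {x // x ∈ A}) : {x // x ∈ A} :=
  if h : α x.1 ∈ A then ⟨α x.1, h⟩ else x

theorem halfArc_of_mem {α : X → X} {A : Set X} {x : {x // x ∈ A}} (h : α x.1 ∈ A) :
    halfArc α A x = ⟨α x.1, h⟩ := dif_pos h

theorem halfArc_of_notMem {α : X → X} {A : Set X} {x : {x // x ∈ A}} (h : α x.1 ∉ A) :
    halfArc α A x = x := dif_neg h

theorem halfArc_involutive {α : X → X} (hα : Function.Involutive α) (A : Set X) :
    Function.Involutive (halfArc α A) := by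
  intro x
  by_cases h : α x.1 ∈ A
  · rw [halfArc_of_mem h, halfArc_of_mem (by rw [hα]; exact x.2)]
    exact Subtype.ext (hα x.1)
  · rw [halfArc_of_notMem h, halfArc_of_notMem h]

theorem halfArc_eq_self_iff {α : X → X} (hα : ∀ x, α x ≠ x) (A : Set X) (x : {x // x ∈ A}) :
    halfArc α A x = x ↔ α x.1 ∉ A := by
  by_cases h : α x.1 ∈ A
  · simp only [halfArc, h, dif_pos, not_true_eq_false, iff_false]
    exact fun he => hα x.1 (congrArg Subtype.val he)
  · simp only [halfArc, h, dif_neg, not_false_eq_true]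

theorem mem_invFun_halfArc {α : X → X} {A : Set X} {f : {x // x ∈ A} → ZMod 2} :
    f ∈ invFun (halfArc α A) ↔ ∀ x (hx : x ∈ A) (h : α x ∈ A), f ⟨α x, h⟩ = f ⟨x, hx⟩ := by
  refine ⟨fun hf x hx h => ?_, fun hf x => ?_⟩
  · have := hf ⟨x, hx⟩
    simpa only [halfArc, h, dif_pos] using this
  · by_cases h : α x.1 ∈ A
    · simp only [halfArc, h, dif_pos]
      exact hf x.1 x.2 h
    · simp only [halfArc, h, dif_neg, not_false_eq_true]

/-- The functions that are constant along those `α`-pairs that do not leave `A` or `Aᶜ`. -/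
def unmixedInv (α : X → X) (A : Set X) : Submodule (ZMod 2) (X → ZMod 2) where
  carrier := {f | ∀ x, (α x ∈ A ↔ x ∈ A) → f (α x) = f x}
  add_mem' := fun hf hg x h => by simp only [Pi.add_apply, hf x h, hg x h]
  zero_mem' := fun _ _ => rfl
  smul_mem' := fun c f hf x h => by simp only [Pi.smul_apply, hf x h]

variable {α : X → X} {A : Set X}

/-- The inclusion of the points that leave `A` under `α`. -/
def mixedIn (m : {x // x ∈ A ∧ α x ∉ A}) : {x // x ∈ A} := ⟨m.1, m.2.1⟩

/-- The points of `Aᶜ` that enter `A` under `α`, numbered by their images. -/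
def mixedOut (m : {x // x ∈ A ∧ α x ∉ A}) : {x // x ∈ Aᶜ} := ⟨α m.1, m.2.2⟩

theorem mixedIn_injective : Function.Injective (mixedIn (α := α) (A := A)) := fun _ _ h =>
  Subtype.ext (congrArg Subtype.val h :)

theorem mixedOut_injective (hα : Function.Involutive α) :
    Function.Injective (mixedOut (α := α) (A := A)) := fun _ _ h =>
  Subtype.ext (hα.injective (congrArg Subtype.val h :))

theorem halfArc_fixed_iff_mixedIn (hα : ∀ x, α x ≠ x) (x : {x // x ∈ A}) :
    halfArc α A x = x ↔ x ∈ Set.range (mixedIn (α := α) (A := A)) := by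
  rw [halfArc_eq_self_iff hα]
  refine ⟨fun h => ⟨⟨x.1, x.2, h⟩, rfl⟩, ?_⟩
  rintro ⟨m, rfl⟩
  exact m.2.2

theorem halfArc_fixed_iff_mixedOut (hα : ∀ x, α x ≠ x) (h2 : Function.Involutive α)
    (x : {x // x ∈ Aᶜ}) :
    halfArc α Aᶜ x = x ↔ x ∈ Set.range (mixedOut (α := α) (A := A)) := by
  rw [halfArc_eq_self_iff hα]
  refine ⟨fun h => ⟨⟨α x.1, not_not.1 h, by rw [h2]; exact x.2⟩, Subtype.ext (h2 _)⟩, ?_⟩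
  rintro ⟨m, rfl⟩
  simp only [mixedOut, h2 m.1, Set.mem_compl_iff, not_not]
  exact m.2.1

variable [Finite X]

/-- An `α`-invariant function is a pair of functions on the two halves, invariant inside each half,
that agree across the mixed arcs. `mixedIn` and `mixedOut` index both traces by the same set, so
agreement is equality of traces. -/
theorem finrank_invFun_inf_eq (hα : Function.Involutive α)
    {U : Submodule (ZMod 2) (X → ZMod 2)}
    {L₁ : Submodule (ZMod 2) ({x // x ∈ A} → ZMod 2)}
    {L₂ : Submodule (ZMod 2) ({x // x ∈ Aᶜ} → ZMod 2)}
    (h : ∀ f, f ∈ U ↔ (fun x : {x // x ∈ A} => f x.1) ∈ L₁ ∧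
      (fun x : {x // x ∈ Aᶜ} => f x.1) ∈ L₂) :
    finrank (ZMod 2) ↥(invFun α ⊓ U) =
      finrank (ZMod 2) (traceKer (halfArc α A) (mixedIn (α := α)) L₁) +
      finrank (ZMod 2) (traceKer (halfArc α Aᶜ) (mixedOut (α := α)) L₂) +
      finrank (ZMod 2) ↥(trace (halfArc α A) (mixedIn (α := α)) L₁ ⊓
        trace (halfArc α Aᶜ) (mixedOut (α := α)) L₂) := by
  cases nonempty_fintype X
  classical
  have key := finrank_prod_inf_ker_coprod (L₁ ⊓ invFun (halfArc α A))
    (L₂ ⊓ invFun (halfArc α Aᶜ)) (LinearMap.funLeft (ZMod 2) (ZMod 2) (mixedIn (α := α)))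
    (LinearMap.funLeft (ZMod 2) (ZMod 2) (mixedOut (α := α)))
  have h1 : finrank (ZMod 2) ↥(invFun α ⊓ U) = _ := finrank_eq_of_split A (U := invFun α ⊓ U)
    (W := (L₁ ⊓ invFun (halfArc α A)).prod (L₂ ⊓ invFun (halfArc α Aᶜ)) ⊓ LinearMap.ker
      ((LinearMap.funLeft (ZMod 2) (ZMod 2) (mixedIn (α := α))).coprod
        (LinearMap.funLeft (ZMod 2) (ZMod 2) (mixedOut (α := α))))) (by
      intro f
      constructor
      · rintro ⟨hf, hU⟩
        refine ⟨⟨⟨((h f).1 hU).1, ?_⟩, ⟨((h f).1 hU).2, ?_⟩⟩, ?_⟩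
        · exact mem_invFun_halfArc.2 fun x _ _ => hf x
        · exact mem_invFun_halfArc.2 fun x _ _ => hf x
        · refine LinearMap.mem_ker.2 (funext fun m => ?_)
          change f m.1 + f (α m.1) = 0
          rw [hf, zmod2_add_self]
      · rintro ⟨⟨⟨h1, h2⟩, ⟨h3, h4⟩⟩, h5⟩
        refine ⟨?_, (h f).2 ⟨h1, h3⟩⟩
        have h6 : ∀ x, x ∈ A → α x ∉ A → f (α x) = f x := fun x hx hx' => by
          have h7 : f x + f (α x) = 0 := congrFun (LinearMap.mem_ker.1 h5) ⟨x, hx, hx'⟩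
          exact (CharTwo.add_eq_zero.1 h7).symm
        intro x
        by_cases hx : x ∈ A
        · by_cases hx' : α x ∈ A
          · exact mem_invFun_halfArc.1 h2 x hx hx'
          · exact h6 x hx hx'
        · by_cases hx' : α x ∈ A
          · have := h6 (α x) hx' (by rwa [hα x])
            rw [hα x] at this
            exact this.symm
          · exact mem_invFun_halfArc.1 h4 x hx hx')
  rw [← h1] at key
  have k1 := finrank_trace_add (β := halfArc α A) (ι := mixedIn (α := α)) L₁
  have k2 := finrank_trace_add (β := halfArc α Aᶜ) (ι := mixedOut (α := α)) L₂
  have k3 := Submodule.finrank_sup_add_finrank_inf_eq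
    (trace (halfArc α A) (mixedIn (α := α)) L₁) (trace (halfArc α Aᶜ) (mixedOut (α := α)) L₂)
  change finrank (ZMod 2) ↥(trace (halfArc α A) (mixedIn (α := α)) L₁ ⊔
    trace (halfArc α Aᶜ) (mixedOut (α := α)) L₂) + _ = _ at key
  omega

theorem finrank_unmixedInv_inf_eq
    {U : Submodule (ZMod 2) (X → ZMod 2)}
    {L₁ : Submodule (ZMod 2) ({x // x ∈ A} → ZMod 2)}
    {L₂ : Submodule (ZMod 2) ({x // x ∈ Aᶜ} → ZMod 2)}
    (h : ∀ f, f ∈ U ↔ (fun x : {x // x ∈ A} => f x.1) ∈ L₁ ∧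
      (fun x : {x // x ∈ Aᶜ} => f x.1) ∈ L₂) :
    finrank (ZMod 2) ↥(unmixedInv α A ⊓ U) =
      finrank (ZMod 2) ↥(L₁ ⊓ invFun (halfArc α A)) +
      finrank (ZMod 2) ↥(L₂ ⊓ invFun (halfArc α Aᶜ)) := by
  rw [← finrank_submodule_prod]
  refine finrank_eq_of_split A fun f => ⟨?_, ?_⟩
  · rintro ⟨hf, hU⟩
    refine ⟨⟨((h f).1 hU).1, ?_⟩, ⟨((h f).1 hU).2, ?_⟩⟩
    · exact mem_invFun_halfArc.2 fun x hx hx' => hf x (iff_of_true hx' hx)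
    · exact mem_invFun_halfArc.2 fun x hx hx' => hf x (iff_of_false hx' hx)
  · rintro ⟨⟨h1, h2⟩, ⟨h3, h4⟩⟩
    refine ⟨fun x hx => ?_, (h f).2 ⟨h1, h3⟩⟩
    by_cases hx' : x ∈ A
    · exact mem_invFun_halfArc.1 h2 x hx' (hx.2 hx')
    · exact mem_invFun_halfArc.1 h4 x hx' (fun h => hx' (hx.1 h))

end HalfArc

/-! ### The rank inequality -/

namespace FlagSystem

variable {X : Type*} (S : FlagSystem X)

/-- A set of flags that is a union of edges. -/
structure IsEdgeSet (A : Set X) : Prop where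
  side_mem : ∀ x, S.side x ∈ A ↔ x ∈ A
  tip_mem : ∀ x, S.tip x ∈ A ↔ x ∈ A

open Classical in
/-- The involution that is `side` on `A` and `tip` elsewhere. -/
noncomputable def twist (A : Set X) (x : X) : X := if x ∈ A then S.side x else S.tip x

/-- The number of vertices of the partial dual with respect to `A`. -/
noncomputable def orbitRank (A : Set X) : ℕ :=
  finrank (ZMod 2) ↥(invFun S.arc ⊓ invFun (S.twist A))

/-- The number of components after cutting the arcs between `A` and its complement. -/
noncomputable def blobRank (A : Set X) : ℕ :=
  finrank (ZMod 2) ↥(unmixedInv S.arc A ⊓ (invFun S.side ⊓ invFun S.tip))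

/-- The number of components. -/
noncomputable def compRank : ℕ :=
  finrank (ZMod 2) ↥(invFun S.arc ⊓ (invFun S.side ⊓ invFun S.tip))

theorem IsEdgeSet.compl {S : FlagSystem X} {A : Set X} (h : S.IsEdgeSet A) : S.IsEdgeSet Aᶜ :=
  ⟨fun x => not_congr (h.side_mem x), fun x => not_congr (h.tip_mem x)⟩

variable {S} {A : Set X} (h : S.IsEdgeSet A)

/-- The restriction of `side` to a union of edges. -/
def IsEdgeSet.side (x : {x // x ∈ A}) : {x // x ∈ A} :=
  ⟨S.side x.1, (h.side_mem x.1).2 x.2⟩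

/-- The restriction of `tip` to a union of edges. -/
def IsEdgeSet.tip (x : {x // x ∈ A}) : {x // x ∈ A} :=
  ⟨S.tip x.1, (h.tip_mem x.1).2 x.2⟩

theorem IsEdgeSet.isLagrangian_side [Fintype {x // x ∈ A}] : IsLagrangian (invFun h.side) :=
  isLagrangian_invFun (fun x => Subtype.ext (S.side_invol x.1))
    (fun x he => S.side_ne x.1 (congrArg Subtype.val he))

theorem IsEdgeSet.isLagrangian_tip [Fintype {x // x ∈ A}] : IsLagrangian (invFun h.tip) :=
  isLagrangian_invFun (fun x => Subtype.ext (S.tip_invol x.1))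
    (fun x he => S.tip_ne x.1 (congrArg Subtype.val he))

theorem IsEdgeSet.card_le [Fintype {x // x ∈ A}] :
    Fintype.card {x // x ∈ A} ≤ 4 * finrank (ZMod 2) ↥(invFun h.side ⊓ invFun h.tip) :=
  card_le_four_mul_finrank (fun x => Subtype.ext (S.side_invol x.1))
    (fun x => Subtype.ext (S.tip_invol x.1)) (fun x he => S.side_ne x.1 (congrArg Subtype.val he))
    (fun x => Subtype.ext (S.comm x.1))

theorem mem_invFun_split {σ : X → X} {σ₁ : {x // x ∈ A} → {x // x ∈ A}}
    {σ₂ : {x // x ∈ Aᶜ} → {x // x ∈ Aᶜ}} (h₁ : ∀ x, (σ₁ x).1 = σ x.1)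
    (h₂ : ∀ x, (σ₂ x).1 = σ x.1) (f : X → ZMod 2) :
    f ∈ invFun σ ↔ (fun x : {x // x ∈ A} => f x.1) ∈ invFun σ₁ ∧
      (fun x : {x // x ∈ Aᶜ} => f x.1) ∈ invFun σ₂ := by
  refine ⟨fun hf => ⟨fun x => ?_, fun x => ?_⟩, fun ⟨k₁, k₂⟩ x => ?_⟩
  · change f (σ₁ x).1 = _
    rw [h₁, hf x.1]
  · change f (σ₂ x).1 = _
    rw [h₂, hf x.1]
  · by_cases hx : x ∈ A
    · have := k₁ ⟨x, hx⟩
      change f (σ₁ _).1 = _ at this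
      rwa [h₁] at this
    · have := k₂ ⟨x, hx⟩
      change f (σ₂ _).1 = _ at this
      rwa [h₂] at this

theorem twist_of_mem {x : X} (hx : x ∈ A) : S.twist A x = S.side x := if_pos hx

theorem twist_of_notMem {x : X} (hx : x ∉ A) : S.twist A x = S.tip x := if_neg hx

-- The choice between `side` and `tip` is made independently on `A` and on `Aᶜ`, so the four counts
-- combine two contributions of one half with two of the other; only the intersection of traces
-- involves both.
include h in
theorem rank_decomposition [Finite X] :
    let P₁ := trace (halfArc S.arc A) (mixedIn (α := S.arc)) (invFun h.tip)
    let P₂ := trace (halfArc S.arc A) (mixedIn (α := S.arc)) (invFun h.side)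
    let Q₁ := trace (halfArc S.arc Aᶜ) (mixedOut (α := S.arc)) (invFun h.compl.tip)
    let Q₂ := trace (halfArc S.arc Aᶜ) (mixedOut (α := S.arc)) (invFun h.compl.side)
    let m₁ := finrank (ZMod 2) (traceKer (halfArc S.arc A) (mixedIn (α := S.arc)) (invFun h.tip))
    let m₂ := finrank (ZMod 2) (traceKer (halfArc S.arc A) (mixedIn (α := S.arc)) (invFun h.side))
    let n₁ := finrank (ZMod 2)
      (traceKer (halfArc S.arc Aᶜ) (mixedOut (α := S.arc)) (invFun h.compl.tip))
    let n₂ := finrank (ZMod 2)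
      (traceKer (halfArc S.arc Aᶜ) (mixedOut (α := S.arc)) (invFun h.compl.side))
    S.orbitRank ∅ = m₁ + n₁ + finrank (ZMod 2) ↥(P₁ ⊓ Q₁) ∧
    S.orbitRank Set.univ = m₂ + n₂ + finrank (ZMod 2) ↥(P₂ ⊓ Q₂) ∧
    S.orbitRank A = m₂ + n₁ + finrank (ZMod 2) ↥(P₂ ⊓ Q₁) ∧
    S.orbitRank Aᶜ = m₁ + n₂ + finrank (ZMod 2) ↥(P₁ ⊓ Q₂) := by
  intro P₁ P₂ Q₁ Q₂ m₁ m₂ n₁ n₂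
  refine ⟨finrank_invFun_inf_eq S.arc_invol (mem_invFun_split (fun x => ?_) (fun x => ?_)),
    finrank_invFun_inf_eq S.arc_invol (mem_invFun_split (fun x => ?_) (fun x => ?_)),
    finrank_invFun_inf_eq S.arc_invol (mem_invFun_split (fun x => ?_) (fun x => ?_)),
    finrank_invFun_inf_eq S.arc_invol (mem_invFun_split (fun x => ?_) (fun x => ?_))⟩
  · exact (twist_of_notMem (Set.notMem_empty _)).symm
  · exact (twist_of_notMem (Set.notMem_empty _)).symm
  · exact (twist_of_mem (Set.mem_univ _)).symm
  · exact (twist_of_mem (Set.mem_univ _)).symm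
  · exact (twist_of_mem x.2).symm
  · exact (twist_of_notMem x.2).symm
  · exact (twist_of_notMem (not_not.2 x.2)).symm
  · exact (twist_of_mem x.2).symm

include h in
/-- The Euler characteristics of a cell decomposition and of a partial dual are bounded in terms of
the pieces into which cutting the mixed arcs separates the flags. -/
theorem orbitRank_inequality [Finite X] :
    2 * (S.orbitRank ∅ + S.orbitRank Set.univ + S.orbitRank A + S.orbitRank Aᶜ) +
      2 * Nat.card {x // x ∈ A ∧ S.arc x ∉ A} ≤
      Nat.card X + 4 * S.blobRank A + 4 * S.compRank := by
  cases nonempty_fintype X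
  classical
  obtain ⟨e1, e2, e3, e4⟩ := rank_decomposition h
  rw [Nat.card_eq_fintype_card, Nat.card_eq_fintype_card]
  have hi := halfArc_involutive S.arc_invol A
  have ho := halfArc_involutive S.arc_invol Aᶜ
  have fi := halfArc_fixed_iff_mixedIn S.arc_ne (A := A)
  have fo := halfArc_fixed_iff_mixedOut S.arc_ne S.arc_invol (A := A)
  have ni := mixedIn_injective (α := S.arc) (A := A)
  have no := mixedOut_injective S.arc_invol (A := A)
  have i1 := traceKer_inequality hi ni fi h.isLagrangian_tip h.isLagrangian_side
  have i2 := traceKer_inequality ho no fo h.compl.isLagrangian_tip h.compl.isLagrangian_side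
  -- All four traces live over the mixed arcs; their cross intersections are those in `e1` to `e4`.
  have q := IsLagrangian.four (isLagrangian_trace hi ni fi h.isLagrangian_tip)
    (isLagrangian_trace hi ni fi h.isLagrangian_side)
    (isLagrangian_trace ho no fo h.compl.isLagrangian_tip)
    (isLagrangian_trace ho no fo h.compl.isLagrangian_side)
  have c1 := h.card_le
  have c2 := h.compl.card_le
  have split : ∀ f : X → ZMod 2, f ∈ invFun S.side ⊓ invFun S.tip ↔
      (fun x : {x // x ∈ A} => f x.1) ∈ invFun h.side ⊓ invFun h.tip ∧
      (fun x : {x // x ∈ Aᶜ} => f x.1) ∈ invFun h.compl.side ⊓ invFun h.compl.tip := fun f => by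
    simp only [Submodule.mem_inf]
    rw [mem_invFun_split (σ := S.side) (σ₁ := h.side) (σ₂ := h.compl.side) (fun _ => rfl)
      (fun _ => rfl), mem_invFun_split (σ := S.tip) (σ₁ := h.tip) (σ₂ := h.compl.tip)
      (fun _ => rfl) (fun _ => rfl)]
    tauto
  have k1 := finrank_invFun_inf_eq S.arc_invol split
  have k2 := finrank_unmixedInv_inf_eq (α := S.arc) split
  have t1 := finrank_trace_add (β := halfArc S.arc A) (ι := mixedIn (α := S.arc))
    (invFun h.side ⊓ invFun h.tip)
  have t2 := finrank_trace_add (β := halfArc S.arc Aᶜ) (ι := mixedOut (α := S.arc))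
    (invFun h.compl.side ⊓ invFun h.compl.tip)
  have s1 := Submodule.finrank_sup_add_finrank_inf_eq
    (trace (halfArc S.arc A) (mixedIn (α := S.arc)) (invFun h.side ⊓ invFun h.tip))
    (trace (halfArc S.arc Aᶜ) (mixedOut (α := S.arc)) (invFun h.compl.side ⊓ invFun h.compl.tip))
  have s2 := Submodule.finrank_sup_add_finrank_inf_eq
    (trace (halfArc S.arc A) (mixedIn (α := S.arc)) (invFun h.tip) ⊓
      trace (halfArc S.arc A) (mixedIn (α := S.arc)) (invFun h.side))
    (trace (halfArc S.arc Aᶜ) (mixedOut (α := S.arc)) (invFun h.compl.tip) ⊓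
      trace (halfArc S.arc Aᶜ) (mixedOut (α := S.arc)) (invFun h.compl.side))
  have mono : ∀ {Y M : Type _} (β : Y → Y) (ι : M → Y) {L L' : Submodule (ZMod 2) (Y → ZMod 2)},
      L ≤ L' → trace β ι L ≤ trace β ι L' := fun β ι L L' hL =>
    Submodule.map_mono (inf_le_inf_right _ hL)
  -- Functions constant on whole edges have traces in both the `side` trace and the `tip` trace. By
  -- `k1`, `k2`, `t1`, `t2` and `s1`, the left-hand dimension is `blobRank - compRank`.
  have s3 := Submodule.finrank_mono (sup_le_sup
    (le_inf (mono (halfArc S.arc A) (mixedIn (α := S.arc))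
      (inf_le_right : invFun h.side ⊓ invFun h.tip ≤ _))
      (mono (halfArc S.arc A) (mixedIn (α := S.arc))
      (inf_le_left : invFun h.side ⊓ invFun h.tip ≤ _)))
    (le_inf (mono (halfArc S.arc Aᶜ) (mixedOut (α := S.arc))
      (inf_le_right : invFun h.compl.side ⊓ invFun h.compl.tip ≤ _))
      (mono (halfArc S.arc Aᶜ) (mixedOut (α := S.arc))
      (inf_le_left : invFun h.compl.side ⊓ invFun h.compl.tip ≤ _))))
  rw [inf_comm (invFun h.tip)] at i1
  rw [inf_comm (invFun h.compl.tip)] at i2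
  have hX : Fintype.card {x // x ∈ A} + Fintype.card {x // x ∈ Aᶜ} = Fintype.card X := by
    have hc := Fintype.card_subtype_compl (· ∈ A)
    have hc' := Fintype.card_subtype_le (· ∈ A)
    change Fintype.card {x // x ∈ Aᶜ} = _ at hc
    omega
  change S.compRank = _ at k1
  change S.blobRank A = _ at k2
  -- Twice the sum of `i1` and `i2`, plus twice `q`, with `c1` and `c2` bounding the number of flags
  -- by four times the number of edges; `s2` and `s3` absorb the trace intersections.
  omega

-- Over two mixed arcs all four cross intersections of traces are lines, so exchanging the
-- contributions of one half does not change the total.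
include h in
theorem orbitRank_add_eq_of_card_eq_two [Finite X]
    (h2 : Nat.card {x // x ∈ A ∧ S.arc x ∉ A} = 2) :
    S.orbitRank ∅ + S.orbitRank Set.univ = S.orbitRank A + S.orbitRank Aᶜ := by
  cases nonempty_fintype X
  classical
  rw [Nat.card_eq_fintype_card] at h2
  obtain ⟨e1, e2, e3, e4⟩ := rank_decomposition h
  have hi := halfArc_involutive S.arc_invol A
  have ho := halfArc_involutive S.arc_invol Aᶜ
  have fi := halfArc_fixed_iff_mixedIn S.arc_ne (A := A)
  have fo := halfArc_fixed_iff_mixedOut S.arc_ne S.arc_invol (A := A)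
  have ni := mixedIn_injective (α := S.arc) (A := A)
  have no := mixedOut_injective S.arc_invol (A := A)
  have p1 := isLagrangian_trace hi ni fi h.isLagrangian_tip
  have p2 := isLagrangian_trace hi ni fi h.isLagrangian_side
  have q1 := isLagrangian_trace ho no fo h.compl.isLagrangian_tip
  have q2 := isLagrangian_trace ho no fo h.compl.isLagrangian_side
  have := p1.finrank_inf_of_card_eq_two q1 h2
  have := p2.finrank_inf_of_card_eq_two q2 h2
  have := p1.finrank_inf_of_card_eq_two q2 h2
  have := p2.finrank_inf_of_card_eq_two q1 h2
  omega

end FlagSystem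

theorem finrank_eq_card_quot {X : Type*} [Finite X] {r : X → X → Prop}
    {U : Submodule (ZMod 2) (X → ZMod 2)} (hU : ∀ f, f ∈ U ↔ ∀ x y, r x y → f x = f y) :
    finrank (ZMod 2) U = Nat.card (Quot r) := by
  classical
  cases nonempty_fintype X
  have : Fintype (Quot r) := Fintype.ofFinite _
  rw [Nat.card_eq_fintype_card, ← finrank_fintype_fun_eq_card (ZMod 2) (η := Quot r)]
  exact LinearEquiv.finrank_eq
    { toFun := fun f q => q.lift f.1 ((hU f.1).1 f.2)
      invFun := fun f => ⟨fun x => f (Quot.mk r x), (hU _).2 fun x y h => by rw [Quot.sound h]⟩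
      map_add' := fun f g => funext fun q => by
        obtain ⟨x, rfl⟩ := Quot.exists_rep q
        rfl
      map_smul' := fun c f => funext fun q => by
        obtain ⟨x, rfl⟩ := Quot.exists_rep q
        rfl
      left_inv := fun f => rfl
      right_inv := fun f => funext fun q => by
        obtain ⟨x, rfl⟩ := Quot.exists_rep q
        rfl }

/-! ### Signs of permutations and numbers of orbits -/

section Sign

variable {Y : Type*} [Fintype Y] [DecidableEq Y]

/-- Disjointness makes invariance under the product the same as invariance under both factors, and
cutting a function along the support of `σ` shows that the two invariant spaces span everything. -/
theorem finrank_invFun_mul {σ τ : Equiv.Perm Y} (h : σ.Disjoint τ) :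
    finrank (ZMod 2) (invFun (σ * τ)) + Fintype.card Y =
      finrank (ZMod 2) (invFun σ) + finrank (ZMod 2) (invFun τ) := by
  have h1 : invFun (σ * τ) = invFun σ ⊓ invFun τ := by
    ext f
    constructor
    · intro hf
      refine ⟨fun x => ?_, fun x => ?_⟩
      · rcases h x with hx | hx
        · rw [hx]
        · have := hf x
          rwa [Equiv.Perm.mul_apply, hx] at this
      · rcases h (τ x) with hx | hx
        · have := hf x
          rwa [Equiv.Perm.mul_apply, hx] at this
        · rw [τ.injective hx]
    · rintro ⟨h1, h2⟩ x
      rw [Equiv.Perm.mul_apply, h1, h2]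
  have h2 : invFun σ ⊔ invFun τ = ⊤ := by
    rw [eq_top_iff]
    intro f _
    refine Submodule.mem_sup.2 ⟨fun x => if σ x = x then f x else 0, fun x => ?_,
      fun x => if σ x = x then 0 else f x, fun x => ?_, funext fun x => ?_⟩
    · by_cases hx : σ x = x
      · rw [hx]
      · have hx' : σ (σ x) ≠ σ x := fun he => hx (σ.injective he)
        exact (if_neg hx').trans (if_neg hx).symm
    · by_cases hx : τ x = x
      · rw [hx]
      · have h1 : σ x = x := (h x).resolve_right hx
        have h2 : σ (τ x) = τ x := (h (τ x)).resolve_right fun he => hx (τ.injective he)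
        simp only [h1, h2, if_true]
    · by_cases hx : σ x = x <;> simp [hx]
  have h3 := Submodule.finrank_sup_add_finrank_inf_eq (invFun σ) (invFun τ)
  rw [h2, finrank_top, finrank_fintype_fun_eq_card, ← h1] at h3
  omega

/-- Restriction to the fixed points is onto, and its kernel on invariant functions is spanned by the
indicator of the support. -/
theorem finrank_invFun_of_isCycle {σ : Equiv.Perm Y} (h : σ.IsCycle) :
    finrank (ZMod 2) (invFun σ) + σ.support.card = Fintype.card Y + 1 := by
  have h1 := finrank_map_add_finrank_inf_ker (invFun σ)
    (LinearMap.funLeft (ZMod 2) (ZMod 2) (Subtype.val : {x // σ x = x} → Y))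
  have h2 : (invFun σ).map
      (LinearMap.funLeft (ZMod 2) (ZMod 2) (Subtype.val : {x // σ x = x} → Y)) = ⊤ := by
    rw [eq_top_iff]
    intro f _
    refine ⟨fun x => if hx : σ x = x then f ⟨x, hx⟩ else 0, fun x => ?_, funext fun x => ?_⟩
    · by_cases hx : σ x = x
      · simp only [hx]
      · have hx' : σ (σ x) ≠ σ x := fun he => hx (σ.injective he)
        simp only [hx, hx', dif_neg, not_false_eq_true]
    · rw [LinearMap.funLeft_apply, dif_pos x.2]
  have h3 : finrank (ZMod 2) ↥(invFun σ ⊓ LinearMap.ker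
      (LinearMap.funLeft (ZMod 2) (ZMod 2) (Subtype.val : {x // σ x = x} → Y))) = 1 := by
    obtain ⟨x, hx, hc⟩ := h
    refine finrank_eq_one ⟨fun y => if σ y = y then 0 else 1, fun y => ?_,
      LinearMap.mem_ker.2 (funext fun y => if_pos y.2)⟩ (fun he => ?_) fun w => ⟨w.1 x, ?_⟩
    · by_cases hy : σ y = y
      · rw [hy]
      · have hy' : σ (σ y) ≠ σ y := fun he => hy (σ.injective he)
        exact (if_neg hy').trans (if_neg hy).symm
    · have := congrFun (congrArg Subtype.val he) x
      simp [hx] at this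
    · refine Subtype.ext (funext fun y => ?_)
      by_cases hy : σ y = y
      · have := congrFun (LinearMap.mem_ker.1 w.2.2) ⟨y, hy⟩
        rw [LinearMap.funLeft_apply] at this
        simp [hy, this]
      · have hw : ∀ n : ℕ, w.1 ((σ ^ n) x) = w.1 x := fun n => by
          induction n with
          | zero => rfl
          | succ n ih => rw [pow_succ', Equiv.Perm.mul_apply, w.2.1, ih]
        obtain ⟨n, rfl⟩ := (hc hy).exists_nat_pow_eq
        simp [hy, hw]
  rw [h2, finrank_top, finrank_fintype_fun_eq_card, h3] at h1
  have h4 := Finset.card_filter_add_card_filter_not (s := (Finset.univ : Finset Y))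
    (fun x => σ x = x)
  rw [Finset.card_univ, ← Fintype.card_subtype] at h4
  have h5 : σ.support = Finset.univ.filter (fun x => ¬ σ x = x) := rfl
  rw [h5]
  omega

/-- The sign of a permutation in terms of the number of its orbits. -/
theorem sign_eq_neg_one_pow (σ : Equiv.Perm Y) :
    Equiv.Perm.sign σ = (-1) ^ (Fintype.card Y + finrank (ZMod 2) (invFun σ)) := by
  induction σ using Equiv.Perm.cycle_induction_on with
  | base_one =>
    have : invFun (1 : Equiv.Perm Y) = ⊤ := eq_top_iff.2 fun f _ x => rfl
    rw [this, finrank_top, finrank_fintype_fun_eq_card, Equiv.Perm.sign_one, ← two_mul, pow_mul]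
    simp
  | base_cycles σ h =>
    have := finrank_invFun_of_isCycle h
    rw [h.sign]
    have h2 : Fintype.card Y + finrank (ZMod 2) (invFun σ) + 1 + 2 * σ.support.card =
      2 * (Fintype.card Y + 1) + σ.support.card := by omega
    have h3 : ((-1 : ℤˣ)) ^ (Fintype.card Y + finrank (ZMod 2) (invFun σ) + 1 +
      2 * σ.support.card) = (-1) ^ (2 * (Fintype.card Y + 1) + σ.support.card) := by rw [h2]
    simp only [pow_add, pow_mul, pow_one, Int.units_sq, one_pow, mul_one, one_mul] at h3 ⊢
    rw [← h3]
    simp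
  | induction_disjoint σ τ h _ h1 h2 =>
    have := finrank_invFun_mul h
    rw [Equiv.Perm.sign_mul, h1, h2, ← pow_add]
    have h3 : Fintype.card Y + finrank (ZMod 2) (invFun σ) +
      (Fintype.card Y + finrank (ZMod 2) (invFun τ)) = Fintype.card Y +
        finrank (ZMod 2) (invFun (σ * τ)) + 2 * Fintype.card Y := by omega
    rw [h3, pow_add _ _ (2 * _), pow_mul]
    simp

end Sign

/-! ### Colourings by involutions and orientability -/

section Colouring

variable {X : Type*}

/-- Two fixed point free involutions have a common proper `2`-colouring. -/
theorem exists_colouring_of_two {a c : X → X} (ha : Function.Involutive a)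
    (hc : Function.Involutive c) (ha0 : ∀ x, a x ≠ x) (hc0 : ∀ x, c x ≠ x) :
    ∃ g : X → ZMod 2, (∀ x, g (a x) = g x + 1) ∧ ∀ x, g (c x) = g x + 1 := by
  classical
  let σ : Equiv.Perm X := ha.toPerm a * hc.toPerm c
  have hσ : ∀ x, σ x = a (c x) := fun x => rfl
  have hconj : ha.toPerm a * σ * (ha.toPerm a)⁻¹ = σ⁻¹ := by
    rw [eq_inv_iff_mul_eq_one]
    ext x
    change a (a (c (a (a (c x))))) = x
    rw [ha, ha, hc]
  have hpow : ∀ (k : ℤ) x, a ((σ ^ k) x) = (σ ^ (-k)) (a x) := by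
    intro k x
    rw [zpow_neg, ← inv_zpow, ← hconj, conj_zpow]
    change a ((σ ^ k) x) = a ((σ ^ k) (a (a x)))
    rw [ha]
  have hsc : ∀ {x y}, σ.SameCycle x y → σ.SameCycle (a x) (a y) := by
    rintro x _ ⟨k, rfl⟩
    exact ⟨-k, (hpow k x).symm⟩
  -- If `a x = σ ^ k x`, the midpoint `σ ^ j x` is fixed by `a` when k = 2j and by `c` when k = 2j +
  -- 1.
  have hno : ∀ x, ¬ σ.SameCycle x (a x) := by
    rintro x ⟨k, hk⟩
    obtain ⟨j, rfl⟩ | ⟨j, rfl⟩ := Int.even_or_odd k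
    · apply ha0 ((σ ^ j) x)
      rw [hpow, ← hk, ← Equiv.Perm.mul_apply, ← zpow_add]
      congr 2
      omega
    · apply hc0 ((σ ^ j) x)
      have h1 : a ((σ ^ (1 + j)) x) = c ((σ ^ j) x) := by
        rw [zpow_add, zpow_one, Equiv.Perm.mul_apply, hσ, ha]
      rw [← h1, hpow, ← hk, ← Equiv.Perm.mul_apply, ← zpow_add]
      congr 2
      omega
  have hca : ∀ x, σ.SameCycle (c x) (a x) := fun x => ⟨1, by rw [zpow_one, hσ, hc]⟩
  -- The classes are the orbits of the group generated by `a` and `c`. Each consists of two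
  -- `σ`-cycles swapped by `a`, and the colour tells whether a point lies on the cycle of the
  -- representative.
  let s : Setoid X :=
    { r := fun x y => σ.SameCycle x y ∨ σ.SameCycle x (a y)
      iseqv :=
        { refl := fun x => Or.inl (Equiv.Perm.SameCycle.refl σ x)
          symm := by
            rintro x y (h | h)
            · exact Or.inl h.symm
            · have := (hsc h).symm
              rw [ha] at this
              exact Or.inr this
          trans := by
            rintro x y z (h | h) (h' | h')
            · exact Or.inl (h.trans h')
            · exact Or.inr (h.trans h')
            · exact Or.inr (h.trans (hsc h'))
            · have := hsc h'
              rw [ha] at this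
              exact Or.inl (h.trans this) } }
  let rep : X → X := fun x => (Quotient.mk s x).out
  have hrep : ∀ x, σ.SameCycle (rep x) x ∨ σ.SameCycle (rep x) (a x) := fun x =>
    Quotient.mk_out (s := s) x
  have hrepa : ∀ x, rep (a x) = rep x := fun x => congrArg Quotient.out
    (Quotient.sound (s := s) (Or.inr (Equiv.Perm.SameCycle.refl σ _)))
  have hrepc : ∀ x, rep (c x) = rep x := fun x => congrArg Quotient.out
    (Quotient.sound (s := s) (Or.inr (hca x)))
  have hxor : ∀ x, σ.SameCycle (rep x) (a x) ↔ ¬ σ.SameCycle (rep x) x := fun x =>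
    ⟨fun h h' => hno x (h'.symm.trans h), (hrep x).resolve_left⟩
  refine ⟨fun x => if σ.SameCycle (rep x) x then 0 else 1, fun x => ?_, fun x => ?_⟩
  · by_cases h : σ.SameCycle (rep x) x
    · simp [hrepa, hxor, h]
    · simp only [hrepa, hxor, h, not_false_eq_true, if_true, if_false]
      decide
  · have h2 : σ.SameCycle (rep x) (c x) ↔ ¬ σ.SameCycle (rep x) x := by
      rw [← hxor]
      exact ⟨fun h => h.trans (hca x), fun h => h.trans (hca x).symm⟩
    by_cases h : σ.SameCycle (rep x) x
    · simp [hrepc, h2, h]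
    · simp only [hrepc, h2, h, not_false_eq_true, if_true, if_false]
      decide

theorem zmod2_add_one_eq_zero {y : ZMod 2} (hy : y ≠ 0) : y + 1 = 0 := by
  revert y
  decide

/-- The permutation `a ∘ c` of a colour class of a common colouring of the involutions
`a` and `c`. -/
def colourPerm {g : X → ZMod 2} {a c : X → X} (ha : Function.Involutive a)
    (hc : Function.Involutive c) (hga : ∀ x, g (a x) = g x + 1) (hgc : ∀ x, g (c x) = g x + 1) :
    Equiv.Perm {x // g x = 0} where
  toFun x := ⟨a (c x.1), by rw [hga, hgc, x.2, add_assoc, zmod2_add_self, add_zero]⟩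
  invFun x := ⟨c (a x.1), by rw [hgc, hga, x.2, add_assoc, zmod2_add_self, add_zero]⟩
  left_inv x := Subtype.ext ((congrArg c (ha (c x.1))).trans (hc x.1))
  right_inv x := Subtype.ext ((congrArg a (hc (a x.1))).trans (ha x.1))

/-- Functions invariant under `a` and `c` are determined on one colour class, and extend from it by
their value at `a x` on the other class. -/
theorem finrank_colourPerm {g : X → ZMod 2} {a c : X → X} (ha : Function.Involutive a)
    (hc : Function.Involutive c) (hga : ∀ x, g (a x) = g x + 1) (hgc : ∀ x, g (c x) = g x + 1) :
    finrank (ZMod 2) (invFun (colourPerm ha hc hga hgc)) =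
      finrank (ZMod 2) ↥(invFun a ⊓ invFun c) := by
  classical
  have h1 : ∀ x, g x ≠ 0 → g (a x) = 0 := fun x hx => by rw [hga, zmod2_add_one_eq_zero hx]
  have h0 : ∀ x, g x = 0 → g (a x) ≠ 0 := fun x hx => by rw [hga, hx]; decide
  have h0' : ∀ x, g x = 0 → g (c x) ≠ 0 := fun x hx => by rw [hgc, hx]; decide
  have h1' : ∀ x, g x ≠ 0 → g (c x) = 0 := fun x hx => by rw [hgc, zmod2_add_one_eq_zero hx]
  symm
  refine LinearEquiv.finrank_eq (LinearEquiv.ofBijective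
    (((LinearMap.funLeft (ZMod 2) (ZMod 2) (Subtype.val : {x // g x = 0} → X)).domRestrict
      (invFun a ⊓ invFun c)).codRestrict (invFun (colourPerm ha hc hga hgc)) fun f x => ?_)
    ⟨fun f f' h => ?_, fun h => ?_⟩)
  · change f.1 (a (c x.1)) = f.1 x.1
    rw [f.2.1, f.2.2]
  · have h' : ∀ x, g x = 0 → f.1 x = f'.1 x := fun x hx =>
      congrFun (congrArg Subtype.val h) ⟨x, hx⟩
    refine Subtype.ext (funext fun x => ?_)
    by_cases hx : g x = 0
    · exact h' x hx
    · rw [← f.2.1, ← f'.2.1, h' _ (h1 x hx)]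
  · refine ⟨⟨fun x => if hx : g x = 0 then h.1 ⟨x, hx⟩ else h.1 ⟨a x, h1 x hx⟩,
      fun x => ?_, fun x => ?_⟩, Subtype.ext (funext fun x => dif_pos x.2)⟩
    · by_cases hx : g x = 0
      · simp only [hx, h0 x hx, dif_pos, dif_neg, not_false_eq_true, ha x]
      · simp only [hx, h1 x hx, dif_pos, dif_neg, not_false_eq_true]
    · by_cases hx : g x = 0
      · simp only [hx, h0' x hx, dif_pos, dif_neg, not_false_eq_true]
        exact h.2 ⟨x, hx⟩
      · simp only [hx, h1' x hx, dif_pos, dif_neg, not_false_eq_true]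
        have h3 : colourPerm ha hc hga hgc ⟨c x, h1' x hx⟩ = ⟨a x, h1 x hx⟩ :=
          Subtype.ext (congrArg a (hc x))
        rw [← h.2 ⟨c x, h1' x hx⟩, h3]

end Colouring

/-- The Euler characteristic of an orientable closed surface is even. -/
theorem FlagSystem.even_of_colouring {X : Type*} [Finite X] (S : FlagSystem X) {g : X → ZMod 2}
    (ga : ∀ x, g (S.arc x) = g x + 1) (gs : ∀ x, g (S.side x) = g x + 1)
    (gt : ∀ x, g (S.tip x) = g x + 1) {n : ℕ} (hn : Nat.card X = 4 * n) :
    Even (finrank (ZMod 2) ↥(invFun S.arc ⊓ invFun S.tip) +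
      finrank (ZMod 2) ↥(invFun S.arc ⊓ invFun S.side) +
      finrank (ZMod 2) ↥(invFun S.side ⊓ invFun S.tip)) := by
  classical
  cases nonempty_fintype X
  have hcard : Fintype.card {x // g x = 0} = 2 * n := by
    have h1 : Fintype.card {x // g x = 0} = Fintype.card {x // ¬ g x = 0} :=
      Fintype.card_congr
        { toFun := fun x => ⟨S.arc x.1, by rw [ga, x.2]; decide⟩
          invFun := fun x => ⟨S.arc x.1, by rw [ga, zmod2_add_one_eq_zero x.2]⟩
          left_inv := fun x => Subtype.ext (S.arc_invol x.1)
          right_inv := fun x => Subtype.ext (S.arc_invol x.1) }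
    have h2 := Fintype.card_subtype_compl (fun x => g x = 0)
    have h3 := Fintype.card_subtype_le (fun x => g x = 0)
    rw [Nat.card_eq_fintype_card] at hn
    omega
  -- The three rotations of a colour class multiply to the identity, so their signs do too; as the
  -- class has even size, each sign is the parity of an orbit count.
  have h1 : colourPerm S.arc_invol S.tip_invol ga gt * colourPerm S.tip_invol S.side_invol gt gs *
      colourPerm S.side_invol S.arc_invol gs ga = 1 := by
    ext x
    change S.arc (S.tip (S.tip (S.side (S.side (S.arc x.1))))) = x.1
    rw [S.tip_invol, S.side_invol, S.arc_invol]
  have h2 := congrArg Equiv.Perm.sign h1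
  rw [Equiv.Perm.sign_mul, Equiv.Perm.sign_mul, sign_eq_neg_one_pow, sign_eq_neg_one_pow,
    sign_eq_neg_one_pow, finrank_colourPerm, finrank_colourPerm, finrank_colourPerm, ← pow_add,
    ← pow_add, hcard, Equiv.Perm.sign_one, inf_comm (invFun S.tip), inf_comm (invFun S.side)
      (invFun S.arc)] at h2
  have h3 : Even (2 * n + finrank (ZMod 2) ↥(invFun S.arc ⊓ invFun S.tip) +
      (2 * n + finrank (ZMod 2) ↥(invFun S.side ⊓ invFun S.tip)) +
      (2 * n + finrank (ZMod 2) ↥(invFun S.arc ⊓ invFun S.side))) := by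
    by_contra hodd
    rw [Nat.not_even_iff_odd] at hodd
    rw [hodd.neg_one_pow] at h2
    exact absurd h2 (by decide)
  rw [Nat.even_iff] at h3 ⊢
  omega

/-! ### The orientation double cover -/

namespace FlagSystem

variable {X : Type*} (S : FlagSystem X)

/-- The orientation double cover. -/
def double : FlagSystem (X × Bool) where
  arc p := (S.arc p.1, !p.2)
  side p := (S.side p.1, !p.2)
  tip p := (S.tip p.1, !p.2)
  arc_invol p := Prod.ext (S.arc_invol p.1) (Bool.not_not p.2)
  side_invol p := Prod.ext (S.side_invol p.1) (Bool.not_not p.2)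
  tip_invol p := Prod.ext (S.tip_invol p.1) (Bool.not_not p.2)
  arc_ne p h := S.arc_ne p.1 (congrArg Prod.fst h)
  side_ne p h := S.side_ne p.1 (congrArg Prod.fst h)
  tip_ne p h := S.tip_ne p.1 (congrArg Prod.fst h)
  comm p := Prod.ext (S.comm p.1) rfl

/-- The map `F ↦ F (·, false) + F (·, true)`. -/
def pushSum (X : Type*) : (X × Bool → ZMod 2) →ₗ[ZMod 2] (X → ZMod 2) :=
  LinearMap.funLeft (ZMod 2) (ZMod 2) (fun x => (x, false)) +
    LinearMap.funLeft (ZMod 2) (ZMod 2) (fun x => (x, true))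

theorem pushSum_apply (F : X × Bool → ZMod 2) (x : X) :
    pushSum X F x = F (x, false) + F (x, true) := rfl

/-- Rank-nullity for the sum over fibres: the image lies in `U`, and the kernel consists of
functions pulled back from `X`, again by elements of `U`. -/
theorem finrank_le_two_mul_of_pushSum [Finite X] {W : Submodule (ZMod 2) (X × Bool → ZMod 2)}
    {U : Submodule (ZMod 2) (X → ZMod 2)} (h1 : ∀ F ∈ W, pushSum X F ∈ U)
    (h2 : ∀ F ∈ W, (∀ x, F (x, true) = F (x, false)) → (fun x => F (x, false)) ∈ U) :
    finrank (ZMod 2) W ≤ 2 * finrank (ZMod 2) U := by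
  have k1 := finrank_map_add_finrank_inf_ker W (pushSum X)
  have k2 : finrank (ZMod 2) (W.map (pushSum X)) ≤ finrank (ZMod 2) U := by
    apply Submodule.finrank_mono
    rintro _ ⟨F, hF, rfl⟩
    exact h1 F hF
  have hker : ∀ F ∈ W ⊓ LinearMap.ker (pushSum X), ∀ x, F (x, true) = F (x, false) :=
    fun F hF x => (CharTwo.add_eq_zero.1 (congrFun (LinearMap.mem_ker.1 hF.2) x)).symm
  have k3 : finrank (ZMod 2) ↥(W ⊓ LinearMap.ker (pushSum X)) ≤ finrank (ZMod 2) U := by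
    refine LinearMap.finrank_le_finrank_of_injective (f := (((LinearMap.funLeft (ZMod 2) (ZMod 2)
      (fun x : X => (x, false))).domRestrict (W ⊓ LinearMap.ker (pushSum X))).codRestrict U
      fun F => h2 F.1 F.2.1 (hker F.1 F.2))) ?_
    intro F F' h
    have h' : ∀ x, F.1 (x, false) = F'.1 (x, false) := fun x =>
      congrFun (congrArg Subtype.val h) x
    refine Subtype.ext (funext fun p => ?_)
    obtain ⟨x, b⟩ := p
    cases b
    · exact h' x
    · rw [hker F.1 F.2, hker F'.1 F'.2, h']
  omega

theorem double_twist (A : Set X) (p : X × Bool) :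
    S.double.twist (Prod.fst ⁻¹' A) p = (S.twist A p.1, !p.2) := by
  by_cases h : p.1 ∈ A
  · rw [twist_of_mem h, twist_of_mem (A := Prod.fst ⁻¹' A) h]
    rfl
  · rw [twist_of_notMem h, twist_of_notMem (A := Prod.fst ⁻¹' A) h]
    rfl

variable {S} {A : Set X}

theorem IsEdgeSet.twist_involutive (h : S.IsEdgeSet A) : Function.Involutive (S.twist A) := by
  intro x
  by_cases hx : x ∈ A
  · rw [twist_of_mem hx, twist_of_mem ((h.side_mem x).2 hx), S.side_invol]
  · rw [twist_of_notMem hx, twist_of_notMem (fun h' => hx ((h.tip_mem x).1 h')), S.tip_invol]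

theorem twist_ne (A : Set X) (x : X) : S.twist A x ≠ x := by
  by_cases hx : x ∈ A
  · rw [twist_of_mem hx]
    exact S.side_ne x
  · rw [twist_of_notMem hx]
    exact S.tip_ne x

theorem IsEdgeSet.double (h : S.IsEdgeSet A) : S.double.IsEdgeSet (Prod.fst ⁻¹' A) :=
  ⟨fun p => h.side_mem p.1, fun p => h.tip_mem p.1⟩

/-- Two involutions alone always have a common colouring `g`, so each orbit lifts to two, told apart
by `g` plus the sheet. The pair `(h, k)` is sent to `h · (g + sheet) + k`. -/
theorem IsEdgeSet.two_mul_orbitRank_le [Finite X] (h : S.IsEdgeSet A) :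
    2 * S.orbitRank A ≤ S.double.orbitRank (Prod.fst ⁻¹' A) := by
  obtain ⟨g, ga, gt⟩ := exists_colouring_of_two S.arc_invol h.twist_involutive S.arc_ne
    (twist_ne A)
  rw [two_mul, orbitRank, ← finrank_prod]
  have key : ∀ (σ : X → X), (∀ x, g (σ x) = g x + 1) → ∀ h k : X → ZMod 2, h ∈ invFun σ →
      k ∈ invFun σ → ∀ p : X × Bool, h (σ p.1) * (g (σ p.1) + (if !p.2 then 1 else 0)) + k (σ p.1) =
        h p.1 * (g p.1 + (if p.2 then 1 else 0)) + k p.1 := by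
    rintro σ hg h k hh hk ⟨x, b⟩
    rw [hh x, hk x, hg x]
    congr 2
    rw [add_assoc]
    cases b
    · exact congrArg (g x + ·) (zmod2_add_self 1)
    · rfl
  refine LinearMap.finrank_le_finrank_of_injective (f :=
    { toFun := fun q => ⟨fun p => q.1.1 p.1 * (g p.1 + (if p.2 then 1 else 0)) + q.2.1 p.1,
        fun p => key S.arc ga _ _ q.1.2.1 q.2.2.1 p, fun p => by
          rw [double_twist]
          exact key _ gt _ _ q.1.2.2 q.2.2.2 p⟩
      map_add' := fun q q' => Subtype.ext (funext fun p => by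
        change (q.1.1 p.1 + q'.1.1 p.1) * _ + (q.2.1 p.1 + q'.2.1 p.1) = _ + _ + (_ + _)
        ring)
      map_smul' := fun c q => Subtype.ext (funext fun p => by
        change (c * q.1.1 p.1) * _ + c * q.2.1 p.1 = c * (_ + _)
        ring) }) ?_
  intro q q' he
  have he' : ∀ p : X × Bool, q.1.1 p.1 * (g p.1 + (if p.2 then 1 else 0)) + q.2.1 p.1 =
      q'.1.1 p.1 * (g p.1 + (if p.2 then 1 else 0)) + q'.2.1 p.1 := fun p =>
    congrFun (congrArg Subtype.val he) p
  have h1 : ∀ x, q.1.1 x = q'.1.1 x := fun x => by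
    have e0 := he' (x, false)
    have e1 := he' (x, true)
    simp only [Bool.false_eq_true, if_false, if_true, add_zero, mul_add, mul_one] at e0 e1
    linear_combination e1 - e0
  have h2 : ∀ x, q.2.1 x = q'.2.1 x := fun x => by
    have e0 := he' (x, false)
    rw [h1] at e0
    exact add_left_cancel e0
  exact Prod.ext (Subtype.ext (funext h1)) (Subtype.ext (funext h2))

theorem double_blobRank_le [Finite X] (S : FlagSystem X) (A : Set X) :
    S.double.blobRank (Prod.fst ⁻¹' A) ≤ 2 * S.blobRank A := by
  have key : ∀ (F : X × Bool → ZMod 2) (x y : X), (∀ b, F (y, !b) = F (x, b)) →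
      pushSum X F y = pushSum X F x := fun F x y hF => by
    rw [pushSum_apply, pushSum_apply, ← hF false, ← hF true, add_comm]
    rfl
  refine finrank_le_two_mul_of_pushSum ?_ ?_
  · rintro F ⟨h1, h2, h3⟩
    exact ⟨fun x hx => key F x _ fun b => h1 (x, b) hx, fun x => key F x _ fun b => h2 (x, b),
      fun x => key F x _ fun b => h3 (x, b)⟩
  · rintro F ⟨h1, h2, h3⟩ h
    exact ⟨fun x hx => (h _).symm.trans (h1 (x, false) hx),
      fun x => (h _).symm.trans (h2 (x, false)), fun x => (h _).symm.trans (h3 (x, false))⟩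

/-- A cell decomposition is connected if it has no proper non-empty union of components. -/
def IsConnected (S : FlagSystem X) : Prop :=
  ∀ T : Set X, S.IsEdgeSet T → (∀ x, S.arc x ∈ T ↔ x ∈ T) → T.Nonempty → T = Set.univ

theorem IsConnected.eq_of_mem (hS : S.IsConnected) {f : X → ZMod 2}
    (hf : f ∈ invFun S.arc ⊓ (invFun S.side ⊓ invFun S.tip)) (x y : X) : f x = f y := by
  have h := hS {z | f z = f y} ⟨fun z => by rw [Set.mem_ofPred_eq, hf.2.1 z]; rfl,
    fun z => by rw [Set.mem_ofPred_eq, hf.2.2 z]; rfl⟩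
    (fun z => by rw [Set.mem_ofPred_eq, hf.1 z]; rfl) ⟨y, rfl⟩
  exact (Set.ext_iff.1 h x).2 trivial

theorem finrank_le_one_of_const [Finite X] {U : Submodule (ZMod 2) (X → ZMod 2)}
    (h : ∀ f ∈ U, ∀ x y, f x = f y) : finrank (ZMod 2) U ≤ 1 := by
  by_cases hX : Nonempty X
  · obtain ⟨x₀⟩ := hX
    refine finrank_le_one_iff.2 ?_
    by_cases h1 : (fun _ => 1 : X → ZMod 2) ∈ U
    · refine ⟨⟨_, h1⟩, fun w => ⟨w.1 x₀, Subtype.ext (funext fun x => ?_)⟩⟩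
      change w.1 x₀ * 1 = w.1 x
      rw [mul_one, h w.1 w.2 x₀ x]
    · refine ⟨0, fun w => ⟨0, ?_⟩⟩
      rw [smul_zero]
      by_contra hw
      apply h1
      have h2 : w.1 x₀ ≠ 0 := fun h0 => hw (Subtype.ext (funext fun x => by
        rw [h w.1 w.2 x x₀, h0]
        rfl))
      have h3 : (fun _ => 1 : X → ZMod 2) = w.1 := funext fun x => by
        rw [h w.1 w.2 x x₀]
        generalize w.1 x₀ = y at h2
        revert y
        decide
      rw [h3]
      exact w.2
  · have : Subsingleton U := ⟨fun f g => Subtype.ext (funext fun x => (hX ⟨x⟩).elim)⟩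
    rw [finrank_zero_of_subsingleton]
    exact zero_le_one

theorem IsConnected.compRank_le [Finite X] (hS : S.IsConnected) : S.compRank ≤ 1 :=
  finrank_le_one_of_const fun _ hf => hS.eq_of_mem hf

/-- The fibre sum of an invariant function is constant on `X`. The value 1 would make its
restriction to one sheet an orientation; the value 0 means that it descends to `X`, where it is
constant. -/
theorem IsConnected.double_compRank_le [Finite X] (hS : S.IsConnected)
    (hno : ¬ ∃ g : X → ZMod 2, (∀ x, g (S.arc x) = g x + 1) ∧ (∀ x, g (S.side x) = g x + 1) ∧
      ∀ x, g (S.tip x) = g x + 1) : S.double.compRank ≤ 1 := by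
  refine finrank_le_one_of_const fun F hF => ?_
  have key : ∀ (x y : X), (∀ b, F (y, !b) = F (x, b)) →
      pushSum X F y = pushSum X F x := fun x y hF => by
    rw [pushSum_apply, pushSum_apply, ← hF false, ← hF true, add_comm]
    rfl
  have h1 := hS.eq_of_mem (f := pushSum X F) ⟨fun x => key x _ fun b => hF.1 (x, b),
    fun x => key x _ fun b => hF.2.1 (x, b), fun x => key x _ fun b => hF.2.2 (x, b)⟩
  have h2 : ∀ x, pushSum X F x = 0 := by
    by_contra! hne
    obtain ⟨x, hx⟩ := hne
    have h3 : ∀ y, F (y, true) = F (y, false) + 1 := fun y => by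
      rw [h1 x y, pushSum_apply] at hx
      generalize F (y, true) = u at hx
      generalize F (y, false) = v at hx
      revert u v
      decide
    have h4 : ∀ x y, F (y, true) = F (x, false) → F (y, false) = F (x, false) + 1 :=
      fun x y h => by
        rw [← h, h3, add_assoc, zmod2_add_self, add_zero]
    exact hno ⟨fun x => F (x, false), fun x => h4 x _ (hF.1 (x, false)),
      fun x => h4 x _ (hF.2.1 (x, false)), fun x => h4 x _ (hF.2.2 (x, false))⟩
  have h3 : ∀ x, F (x, true) = F (x, false) := fun x => (CharTwo.add_eq_zero.1 (h2 x)).symm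
  have h4 := hS.eq_of_mem (f := fun x => F (x, false))
    ⟨fun x => (h3 _).symm.trans (hF.1 (x, false)), fun x => (h3 _).symm.trans (hF.2.1 (x, false)),
      fun x => (h3 _).symm.trans (hF.2.2 (x, false))⟩
  rintro ⟨x, b⟩ ⟨y, b'⟩
  have h5 : ∀ z b, F (z, b) = F (z, false) := fun z b => by
    cases b
    · rfl
    · exact h3 z
  rw [h5, h5 y]
  exact h4 x y

theorem card_double_mixed [Finite X] (S : FlagSystem X) (A : Set X) :
    Nat.card {p : X × Bool // p ∈ Prod.fst ⁻¹' A ∧ S.double.arc p ∉ Prod.fst ⁻¹' A} =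
      2 * Nat.card {x // x ∈ A ∧ S.arc x ∉ A} := by
  have h : Nat.card Bool = 2 := by simp
  rw [mul_comm, ← h, ← Nat.card_prod]
  exact Nat.card_congr
    { toFun := fun p => (⟨p.1.1, p.2⟩, p.1.2)
      invFun := fun q => ⟨(q.1.1, q.2), q.1.2⟩
      left_inv := fun _ => rfl
      right_inv := fun _ => rfl }

/-- Few mixed arcs compared with the number of pieces: partial duals of Euler genus at most one. -/
theorem IsConnected.card_mixed_lt [Finite X] (hS : S.IsConnected) (hA : S.IsEdgeSet A) {n c : ℕ}
    (hc : c = 1 ∨ c = 2) (hn : Nat.card X = 4 * n)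
    (he : finrank (ZMod 2) ↥(invFun S.side ⊓ invFun S.tip) = n)
    (h1 : S.orbitRank ∅ + S.orbitRank Set.univ = n + c)
    (h2 : S.orbitRank A + S.orbitRank Aᶜ = n + c) :
    Nat.card {x // x ∈ A ∧ S.arc x ∉ A} < 2 * S.blobRank A := by
  have k1 := orbitRank_inequality hA
  have k2 := hS.compRank_le
  rcases hc with rfl | rfl
  · have hno : ¬ ∃ g : X → ZMod 2, (∀ x, g (S.arc x) = g x + 1) ∧
        (∀ x, g (S.side x) = g x + 1) ∧ ∀ x, g (S.tip x) = g x + 1 := by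
      rintro ⟨g, ga, gs, gt⟩
      have := S.even_of_colouring ga gs gt hn
      have e1 : S.twist ∅ = S.tip := funext fun x => twist_of_notMem (Set.notMem_empty x)
      have e2 : S.twist Set.univ = S.side := funext fun x => twist_of_mem (Set.mem_univ x)
      rw [orbitRank, orbitRank, e1, e2] at h1
      rw [h1, he, Nat.even_iff] at this
      omega
    -- On `X` the inequality is off by one. On the cover all other terms at least double in the
    -- useful direction, but there is still only one component, which gives strictness.
    have k3 := hS.double_compRank_le hno
    have k4 := orbitRank_inequality hA.double
    have hempty : S.IsEdgeSet ∅ := ⟨fun _ => Iff.rfl, fun _ => Iff.rfl⟩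
    have huniv : S.IsEdgeSet Set.univ := ⟨fun _ => Iff.rfl, fun _ => Iff.rfl⟩
    have k5 := hempty.two_mul_orbitRank_le
    have k6 := huniv.two_mul_orbitRank_le
    have k7 := hA.two_mul_orbitRank_le
    have k8 := hA.compl.two_mul_orbitRank_le
    rw [Set.preimage_empty] at k5
    rw [Set.preimage_univ] at k6
    rw [Set.preimage_compl] at k8
    have k9 := double_blobRank_le S A
    have k10 : Nat.card (X × Bool) = 2 * Nat.card X := by
      rw [Nat.card_prod, mul_comm]
      simp
    rw [card_double_mixed] at k4
    omega
  · omega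

/-! ### Pieces with exactly two mixed arcs -/

/-- A set that is a union of edge ends has an even number of mixed arcs. -/
theorem even_card_mixed [Finite X] {τ : X → X} (hτ : Function.Involutive τ) (hτ0 : ∀ x, τ x ≠ x)
    {P : Set X} (hP : ∀ x, τ x ∈ P ↔ x ∈ P) :
    Even (Nat.card {x // x ∈ P ∧ S.arc x ∉ P}) := by
  classical
  cases nonempty_fintype X
  have h1 : ∑ x, (if x ∈ P then 1 else 0 : ZMod 2) = 0 :=
    sum_eq_zero_of_involutive hτ hτ0 fun x => by simp only [hP]
  have h2 : ∑ x, (if x ∈ P ∧ S.arc x ∈ P then 1 else 0 : ZMod 2) = 0 :=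
    sum_eq_zero_of_involutive S.arc_invol S.arc_ne fun x => by
      simp only [S.arc_invol x, and_comm]
  have h3 : ∑ x, (if x ∈ P ∧ S.arc x ∉ P then 1 else 0 : ZMod 2) = 0 := by
    refine Eq.trans ?_ ((congrArg₂ (· + ·) h1 h2).trans (add_zero 0))
    rw [← Finset.sum_add_distrib]
    refine Finset.sum_congr rfl fun x _ => ?_
    by_cases hx : x ∈ P <;> by_cases hx' : S.arc x ∈ P <;> simp [hx, hx', zmod2_add_self]
  rw [Finset.sum_boole, ZMod.natCast_eq_zero_iff_even] at h3
  rwa [Nat.card_eq_fintype_card, Fintype.card_subtype]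

/-- A piece with exactly two mixed arcs. -/
theorem IsConnected.exists_piece [Finite X] (hS : S.IsConnected) (hA : S.IsEdgeSet A)
    (hne : A.Nonempty) (hne' : Aᶜ.Nonempty)
    (hlt : Nat.card {x // x ∈ A ∧ S.arc x ∉ A} < 2 * S.blobRank A) :
    ∃ Q, S.IsEdgeSet Q ∧ (Q ⊆ A ∨ Q ⊆ Aᶜ) ∧ Nat.card {x // x ∈ Q ∧ S.arc x ∉ Q} = 2 ∧
      ∀ x ∈ Q, (S.arc x ∈ A ↔ x ∈ A) → S.arc x ∈ Q := by
  classical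
  cases nonempty_fintype X
  let r : X → X → Prop := fun x y => y = S.side x ∨ y = S.tip x ∨
    (y = S.arc x ∧ (S.arc x ∈ A ↔ x ∈ A))
  have hb : S.blobRank A = Nat.card (Quot r) := by
    refine finrank_eq_card_quot fun f => ⟨?_, fun h => ⟨fun x hx => ?_, fun x => ?_, fun x => ?_⟩⟩
    · rintro ⟨h1, h2, h3⟩ x y (rfl | rfl | ⟨rfl, hx⟩)
      · exact (h2 x).symm
      · exact (h3 x).symm
      · exact (h1 x hx).symm
    · exact (h x _ (Or.inr (Or.inr ⟨rfl, hx⟩))).symm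
    · exact (h x _ (Or.inl rfl)).symm
    · exact (h x _ (Or.inr (Or.inl rfl))).symm
  have : Fintype (Quot r) := Fintype.ofFinite _
  -- `D` collects both ends of every mixed arc.
  let D : Finset X := Finset.univ.filter fun x => ¬ (S.arc x ∈ A ↔ x ∈ A)
  have hD : D.card = 2 * Nat.card {x // x ∈ A ∧ S.arc x ∉ A} := by
    rw [Nat.card_eq_fintype_card, Fintype.card_subtype, two_mul]
    have e1 : D = (Finset.univ.filter fun x => x ∈ A ∧ S.arc x ∉ A) ∪
        (Finset.univ.filter fun x => x ∈ A ∧ S.arc x ∉ A).image S.arc := by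
      ext x
      simp only [D, Finset.mem_filter, Finset.mem_univ, true_and, Finset.mem_union,
        Finset.mem_image]
      constructor
      · intro h
        by_cases hx : x ∈ A
        · exact Or.inl ⟨hx, fun h' => h (iff_of_true h' hx)⟩
        · refine Or.inr ⟨S.arc x, ⟨?_, ?_⟩, S.arc_invol x⟩
          · by_contra h'
            exact h (iff_of_false h' hx)
          · rwa [S.arc_invol x]
      · rintro (⟨h1, h2⟩ | ⟨y, ⟨h1, h2⟩, rfl⟩) h
        · exact h2 (h.2 h1)
        · rw [S.arc_invol y] at h
          exact h2 (h.1 h1)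
    rw [e1, Finset.card_union_of_disjoint, Finset.card_image_of_injective _ S.arc_invol.injective]
    rw [Finset.disjoint_left]
    intro x hx hx'
    obtain ⟨y, hy, rfl⟩ := Finset.mem_image.1 hx'
    exact (Finset.mem_filter.1 hy).2.2 (Finset.mem_filter.1 hx).2.1
  -- Pigeonhole: `D` has fewer than four points per piece on average. Parity and connectedness then
  -- leave only the value 2.
  obtain ⟨q, hq⟩ : ∃ q : Quot r, (D.filter fun x => Quot.mk r x = q).card < 4 := by
    by_contra! h
    have h1 := Finset.card_eq_sum_card_fiberwise (f := Quot.mk r) (s := D) (t := Finset.univ)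
      (fun _ _ => Finset.mem_coe.2 (Finset.mem_univ _))
    have h2 := Finset.card_nsmul_le_sum Finset.univ
      (fun q => (D.filter fun x => Quot.mk r x = q).card) 4 (fun q _ => h q)
    rw [Finset.card_univ, smul_eq_mul, ← Nat.card_eq_fintype_card, ← hb, ← h1] at h2
    omega
  have hAr : ∀ x y, r x y → (x ∈ A) = (y ∈ A) := by
    rintro x y (rfl | rfl | ⟨rfl, hx⟩)
    · exact propext (hA.side_mem x).symm
    · exact propext (hA.tip_mem x).symm
    · exact propext hx.symm
  have hcl : ∀ {x y}, r x y → (Quot.mk r y = q ↔ Quot.mk r x = q) := fun h => by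
    rw [Quot.sound h]
  have hcol : ∀ x, Quot.mk r x = q → (x ∈ A) = q.lift (· ∈ A) hAr := by
    rintro x rfl
    rfl
  have hQ : S.IsEdgeSet {x | Quot.mk r x = q} :=
    ⟨fun x => hcl (Or.inl rfl), fun x => hcl (Or.inr (Or.inl rfl))⟩
  have hun : ∀ x, Quot.mk r x = q → (S.arc x ∈ A ↔ x ∈ A) → Quot.mk r (S.arc x) = q :=
    fun x hx hx' => (hcl (Or.inr (Or.inr ⟨rfl, hx'⟩))).2 hx
  have hsub : {x | Quot.mk r x = q} ⊆ A ∨ {x | Quot.mk r x = q} ⊆ Aᶜ := by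
    by_cases hq : q.lift (· ∈ A) hAr
    · exact Or.inl fun x hx => by
        have := hcol x hx
        rwa [eq_true hq, eq_iff_iff, iff_true] at this
    · exact Or.inr fun x hx => by
        have := hcol x hx
        rwa [eq_false hq, eq_iff_iff, iff_false] at this
  refine ⟨{x | Quot.mk r x = q}, hQ, hsub, ?_, hun⟩
  have hle : Nat.card {x // Quot.mk r x = q ∧ ¬ Quot.mk r (S.arc x) = q} < 4 := by
    rw [Nat.card_eq_fintype_card, Fintype.card_subtype]
    refine lt_of_le_of_lt (Finset.card_le_card fun x hx => ?_) hq
    simp only [Finset.mem_filter, Finset.mem_univ, true_and, D] at hx ⊢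
    exact ⟨fun h => hx.2 (hun x hx.1 h), hx.1⟩
  have hev := even_card_mixed (S := S) S.tip_invol S.tip_ne hQ.tip_mem
  have hpos : Nat.card {x // Quot.mk r x = q ∧ ¬ Quot.mk r (S.arc x) = q} ≠ 0 := by
    intro h0
    have h1 : ∀ x, Quot.mk r x = q → Quot.mk r (S.arc x) = q := fun x hx => by
      by_contra hx'
      have := (Finite.card_eq_zero_iff).1 h0
      exact this.elim ⟨x, hx, hx'⟩
    have h2 := hS _ hQ (fun x => ⟨fun h => by
      have := h1 _ h
      rwa [S.arc_invol] at this, h1 x⟩) (by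
        obtain ⟨x, rfl⟩ := Quot.exists_rep q
        exact ⟨x, rfl⟩)
    obtain ⟨x, hx⟩ := hne
    obtain ⟨y, hy⟩ := hne'
    rcases hsub with h | h
    · exact hy (h (h2 ▸ Set.mem_univ y))
    · exact h (h2 ▸ Set.mem_univ x) hx
  change Even (Nat.card {x // Quot.mk r x = q ∧ ¬ Quot.mk r (S.arc x) = q}) at hev
  change Nat.card {x // Quot.mk r x = q ∧ ¬ Quot.mk r (S.arc x) = q} = 2
  rw [Nat.even_iff] at hev
  omega

end FlagSystem

namespace FlagSystem

variable {X : Type*} {S : FlagSystem X}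

theorem IsConnected.mem_of_closed (hS : S.IsConnected) {T : Set X} (h1 : ∀ x ∈ T, S.side x ∈ T)
    (h2 : ∀ x ∈ T, S.tip x ∈ T) (h3 : ∀ x ∈ T, S.arc x ∈ T) (hne : T.Nonempty) (x : X) :
    x ∈ T := by
  rw [hS T ⟨fun x => ⟨fun h => ?_, h1 x⟩, fun x => ⟨fun h => ?_, h2 x⟩⟩
    (fun x => ⟨fun h => ?_, h3 x⟩) hne]
  · trivial
  · have := h1 _ h
    rwa [S.side_invol] at this
  · have := h2 _ h
    rwa [S.tip_invol] at this
  · have := h3 _ h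
    rwa [S.arc_invol] at this

theorem card_mixed_compl (S : FlagSystem X) (A : Set X) :
    Nat.card {x // x ∈ Aᶜ ∧ S.arc x ∉ Aᶜ} = Nat.card {x // x ∈ A ∧ S.arc x ∉ A} :=
  Nat.card_congr
    { toFun := fun x => ⟨S.arc x.1, not_not.1 x.2.2, by rw [S.arc_invol]; exact x.2.1⟩
      invFun := fun x => ⟨S.arc x.1, x.2.2, by rw [S.arc_invol]; exact not_not.2 x.2.1⟩
      left_inv := fun x => Subtype.ext (S.arc_invol x.1)
      right_inv := fun x => Subtype.ext (S.arc_invol x.1) }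

theorem exists_pair_of_card_mixed {A : Set X} (h : Nat.card {x // x ∈ A ∧ S.arc x ∉ A} = 2) :
    ∃ p q, p ≠ q ∧ ∀ x, (x ∈ A ∧ S.arc x ∉ A) ↔ (x = p ∨ x = q) := by
  obtain ⟨p, q, hpq, hu⟩ := Nat.card_eq_two_iff.1 h
  refine ⟨p.1, q.1, fun he => hpq (Subtype.ext he), fun x => ⟨fun hx => ?_, ?_⟩⟩
  · have : (⟨x, hx⟩ : {x // x ∈ A ∧ S.arc x ∉ A}) ∈ ({p, q} : Set _) := hu ▸ Set.mem_univ _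
    rcases this with h | h
    · exact Or.inl (congrArg Subtype.val h)
    · exact Or.inr (congrArg Subtype.val h)
  · rintro (rfl | rfl)
    · exact p.2
    · exact q.2

/-- A union of edge ends cannot be left by an odd number of arcs, so `p` is not the only exit. -/
theorem mem_of_mixed_pair [Finite X] {T : Set X} (hT : ∀ x, S.tip x ∈ T ↔ x ∈ T) {p q : X}
    (h : ∀ x ∈ T, S.arc x ∉ T → x = p ∨ x = q) (hp : p ∈ T) (hp' : S.arc p ∉ T) : q ∈ T := by
  by_contra hq
  have hev := even_card_mixed (S := S) S.tip_invol S.tip_ne hT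
  have h1 : Nat.card {x // x ∈ T ∧ S.arc x ∉ T} = 1 := by
    rw [Nat.card_eq_one_iff_unique]
    refine ⟨⟨fun x y => Subtype.ext ?_⟩, ⟨p, hp, hp'⟩⟩
    have : ∀ z : {x // x ∈ T ∧ S.arc x ∉ T}, z.1 = p := fun z =>
      (h z.1 z.2.1 z.2.2).resolve_right fun hz => hq (hz ▸ z.2.1)
    rw [this x, this y]
  rw [h1] at hev
  exact absurd hev (by decide)

end FlagSystem

/-! ### Ribbon graphs as flag systems, and joins -/

namespace RibbonGraph

open Corner FlagSystem

variable {E : Type*}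

theorem acrossEnd_acrossEnd (x : Corner E) : acrossEnd (acrossEnd x) = x := by
  simp [acrossEnd]

theorem alongSide_alongSide (x : Corner E) : alongSide (alongSide x) = x := by
  simp [alongSide]

theorem acrossEnd_ne (x : Corner E) : acrossEnd x ≠ x := fun h => by
  have := congrArg (fun y => y.2.2) h
  simp [acrossEnd] at this

theorem alongSide_ne (x : Corner E) : alongSide x ≠ x := fun h => by
  have := congrArg (fun y => y.2.2) h
  simp [alongSide] at this

/-- The corners of a ribbon graph are the flags of a cell decomposition. -/
def flags (G : RibbonGraph E) : FlagSystem (Corner E) where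
  arc := G.arc
  side := alongSide
  tip := acrossEnd
  arc_invol := G.arc_arc
  side_invol := alongSide_alongSide
  tip_invol := acrossEnd_acrossEnd
  arc_ne := G.arc_ne
  side_ne := alongSide_ne
  tip_ne := acrossEnd_ne
  comm _ := rfl

/-- The corners of the edges in `A`. -/
def corners (A : Set E) : Set (Corner E) := {x | x.1 ∈ A}

theorem isEdgeSet_corners (G : RibbonGraph E) (A : Set E) : G.flags.IsEdgeSet (corners A) :=
  ⟨fun _ => Iff.rfl, fun _ => Iff.rfl⟩

theorem exists_eq_corners {G : RibbonGraph E} {T : Set (Corner E)} (h : G.flags.IsEdgeSet T) :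
    ∃ A : Set E, T = corners A := by
  refine ⟨{e | (e, false, false) ∈ T}, ?_⟩
  ext ⟨e, i, b⟩
  have h1 : ∀ i b, (e, i, !b) ∈ T ↔ (e, i, b) ∈ T := fun i b => h.tip_mem (e, i, b)
  have h2 : ∀ i b, (e, !i, !b) ∈ T ↔ (e, i, b) ∈ T := fun i b => h.side_mem (e, i, b)
  change _ ↔ (e, false, false) ∈ T
  cases i <;> cases b
  · exact Iff.rfl
  · exact h1 false false
  · exact (h1 true true).trans (h2 false false)
  · exact h2 false false

variable (G : RibbonGraph E)

theorem vertexAt_arc (x : Corner E) : G.vertexAt (G.arc x) = G.vertexAt x :=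
  congrArg Sum.inl (Quot.sound (r := fun x y => y = G.arc x ∨ y = acrossEnd x)
    (Or.inl rfl : G.arc x = G.arc x ∨ _)).symm

theorem vertexAt_acrossEnd (x : Corner E) : G.vertexAt (acrossEnd x) = G.vertexAt x :=
  congrArg Sum.inl (Quot.sound (r := fun x y => y = G.arc x ∨ y = acrossEnd x)
    (Or.inr rfl : _ ∨ acrossEnd x = acrossEnd x)).symm

theorem vertexAt_eq (x : Corner E) : G.vertexAt x = G.endVertex x.1 x.2.1 := by
  obtain ⟨e, i, b⟩ := x
  cases b
  · rfl
  · exact G.vertexAt_acrossEnd (e, i, false)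

variable {G}

theorem mem_of_vertexAt_eq {Z : Set (Corner E)} (h1 : ∀ x ∈ Z, G.arc x ∈ Z)
    (h2 : ∀ x ∈ Z, acrossEnd x ∈ Z) {x y : Corner E} (h : G.vertexAt x = G.vertexAt y)
    (hx : x ∈ Z) : y ∈ Z := by
  have key : ∀ x y : Corner E, (y = G.arc x ∨ y = acrossEnd x) → (x ∈ Z) = (y ∈ Z) := by
    rintro x y (rfl | rfl)
    · refine propext ⟨h1 x, fun h => ?_⟩
      have := h1 _ h
      rwa [G.arc_arc] at this
    · refine propext ⟨h2 x, fun h => ?_⟩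
      have := h2 _ h
      rwa [acrossEnd_acrossEnd] at this
  have : (x ∈ Z) = (y ∈ Z) := congrArg (Quot.lift (· ∈ Z) key) (Sum.inl_injective h)
  rwa [← this]

theorem isolated_eq_zero_of_connected [Nonempty E] (h : G.Connected) : G.isolated = 0 := by
  by_contra h0
  obtain ⟨e⟩ := ‹Nonempty E›
  have h1 := h.2 (G.endVertex e false) (Set.mem_univ _)
    (Sum.inr ⟨0, Nat.pos_of_ne_zero h0⟩) (Set.mem_univ _)
  rcases Relation.ReflTransGen.cases_tail h1 with h2 | ⟨c, _, e', _, i, _, h3⟩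
  · exact Sum.inr_ne_inl h2
  · exact Sum.inr_ne_inl h3

theorem flags_isConnected_of_connected (h : G.Connected) : G.flags.IsConnected := by
  intro T h1 h2 ⟨x, hx⟩
  rw [Set.eq_univ_iff_forall]
  intro y
  have key : ∀ v, Relation.ReflTransGen G.whole.Adj (G.vertexAt x) v →
      ∀ z, v = G.vertexAt z → z ∈ T := by
    have hcl : ∀ {z z'}, G.vertexAt z = G.vertexAt z' → z ∈ T → z' ∈ T := fun h =>
      mem_of_vertexAt_eq (fun x => (h2 x).2) (fun x => (h1.tip_mem x).2) h
    intro v hv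
    induction hv with
    | refl => exact fun z hz => hcl hz hx
    | tail _ hadj ih =>
      obtain ⟨e, _, i, ha, hb⟩ := hadj
      intro z hz
      have k1 := ih (e, i, false) ha
      have k2 : (e, !i, true) ∈ T := (h1.side_mem _).2 k1
      exact hcl ((vertexAt_eq G _).trans (hb.symm.trans hz)) k2
  exact key _ (h.2 _ (Set.mem_univ _) _ (Set.mem_univ _)) y rfl

variable (G) in
/-- The ribbon subgraph consisting of a set of edges and their end vertices. -/
def spanned (P : Set E) : G.Subgraph where
  verts := {v | ∃ e ∈ P, ∃ i, v = G.endVertex e i}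
  edges := P
  endVertex_mem := fun e he i => ⟨e, he, i, rfl⟩

/-- A path can leave and re-enter `P` only at `w`, so its excursions outside `P` can be dropped; the
closed set in the proof records an excursion by the fact that `w` has been reached. -/
theorem spanned_connected (h : G.flags.IsConnected) {P : Set E} (hP : P.Nonempty) {w : G.Vertex}
    (hw : ∀ x : Corner E, x.1 ∈ P → (G.arc x).1 ∉ P → G.vertexAt x = w) :
    (G.spanned P).Connected := by
  obtain ⟨e₀, he₀⟩ := hP
  refine ⟨⟨_, e₀, he₀, false, rfl⟩, ?_⟩
  rintro a ⟨e, he, i, rfl⟩ b ⟨e', he', i', rfl⟩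
  have key := h.mem_of_closed (T := {y | (y.1 ∈ P ∧
    Relation.ReflTransGen (G.spanned P).Adj (G.endVertex e i) (G.vertexAt y)) ∨
      (y.1 ∉ P ∧ Relation.ReflTransGen (G.spanned P).Adj (G.endVertex e i) w)})
    ?_ ?_ ?_ ⟨(e, i, false), Or.inl ⟨he, Relation.ReflTransGen.refl⟩⟩ (e', i', false)
  · rcases key with h | h
    · exact h.2
    · exact (h.1 he').elim
  · rintro y (⟨h1, h2⟩ | h1)
    · refine Or.inl ⟨h1, h2.tail ⟨y.1, h1, y.2.1, G.vertexAt_eq y, G.vertexAt_eq (alongSide y)⟩⟩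
    · exact Or.inr h1
  · rintro y (⟨h1, h2⟩ | h1)
    · refine Or.inl ⟨h1, ?_⟩
      change Relation.ReflTransGen _ _ (G.vertexAt (acrossEnd y))
      rwa [vertexAt_acrossEnd]
    · exact Or.inr h1
  · rintro y (⟨h1, h2⟩ | ⟨h1, h2⟩)
    · by_cases h3 : (G.arc y).1 ∈ P
      · refine Or.inl ⟨h3, ?_⟩
        change Relation.ReflTransGen _ _ (G.vertexAt (G.arc y))
        rwa [vertexAt_arc]
      · refine Or.inr ⟨h3, ?_⟩
        rwa [hw y h1 h3] at h2
    · by_cases h3 : (G.arc y).1 ∈ P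
      · refine Or.inl ⟨h3, ?_⟩
        change Relation.ReflTransGen _ _ (G.vertexAt (G.arc y))
        rwa [hw (G.arc y) h3 (by rwa [G.arc_arc])]
      · exact Or.inr ⟨h3, h2⟩

theorem exists_vertexAt (h0 : G.isolated = 0) (v : G.Vertex) : ∃ x, v = G.vertexAt x := by
  rcases v with q | i
  · obtain ⟨x, rfl⟩ := Quot.exists_rep q
    exact ⟨x, rfl⟩
  · have := i.2
    omega

theorem connected_of_flags [Nonempty E] (h0 : G.isolated = 0) (h : G.flags.IsConnected) :
    G.Connected := by
  obtain ⟨e⟩ := ‹Nonempty E›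
  have h1 := spanned_connected h (P := Set.univ) ⟨e, trivial⟩ (w := G.endVertex e false)
    (fun x _ hx => (hx trivial).elim)
  refine ⟨⟨_, Set.mem_univ (G.endVertex e false)⟩, fun a _ b _ => ?_⟩
  obtain ⟨x, rfl⟩ := exists_vertexAt h0 a
  obtain ⟨y, rfl⟩ := exists_vertexAt h0 b
  exact h1.2 _ ⟨x.1, trivial, x.2.1, G.vertexAt_eq x⟩ _ ⟨y.1, trivial, y.2.1, G.vertexAt_eq y⟩

theorem next_injective (G : RibbonGraph E) : Function.Injective G.next := fun x y h => by
  have := congrArg G.arc h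
  rw [next, next, G.arc_arc, G.arc_arc] at this
  rw [← acrossEnd_acrossEnd x, this, acrossEnd_acrossEnd]

/-- A partition of the edges of a connected ribbon graph with exactly two arcs between the parts
is a join. -/
theorem isJoin_of_card_mixed_eq_two [Finite E] (h0 : G.isolated = 0) (h : G.flags.IsConnected)
    {P : Set E} (hP : Nat.card {x // x ∈ corners P ∧ G.flags.arc x ∉ corners P} = 2) :
    G.IsJoin (G.spanned P) (G.spanned Pᶜ) := by
  classical
  obtain ⟨p, q, hpq, hmix⟩ := exists_pair_of_card_mixed hP
  change ∀ x : Corner E, (x.1 ∈ P ∧ (G.arc x).1 ∉ P) ↔ _ at hmix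
  obtain ⟨hp, hp'⟩ := (hmix p).2 (Or.inl rfl)
  have hne : Nonempty E := ⟨p.1⟩
  -- Parity for the corners of `P` at the vertex of `p`.
  have hvq : G.vertexAt q = G.vertexAt p := by
    have : q ∈ {x : Corner E | x.1 ∈ P ∧ G.vertexAt x = G.vertexAt p} := by
      refine mem_of_mixed_pair (S := G.flags) (p := p) (fun x => ?_) (fun x hx hx' => ?_)
        ⟨hp, rfl⟩ (fun h => hp' h.1)
      · refine and_congr Iff.rfl ?_
        change G.vertexAt (acrossEnd x) = _ ↔ _
        rw [vertexAt_acrossEnd]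
      · refine (hmix x).1 ⟨hx.1, fun h => hx' ⟨h, ?_⟩⟩
        exact (G.vertexAt_arc x).trans hx.2
    exact this.2
  have hw : ∀ x : Corner E, x.1 ∈ P → (G.arc x).1 ∉ P → G.vertexAt x = G.vertexAt p :=
    fun x h1 h2 => by
      rcases (hmix x).1 ⟨h1, h2⟩ with rfl | rfl
      · rfl
      · exact hvq
  have hw' : ∀ x : Corner E, x.1 ∈ Pᶜ → (G.arc x).1 ∉ Pᶜ → G.vertexAt x = G.vertexAt p :=
    fun x h1 h2 => by
      rw [← vertexAt_arc]
      exact hw _ (not_not.1 h2) (by rwa [G.arc_arc])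
  refine ⟨G.vertexAt p, ⟨connected_of_flags h0 h, spanned_connected h ⟨_, hp⟩ hw,
    spanned_connected h ⟨_, hp'⟩ hw', ⟨_, hp⟩, ⟨_, hp'⟩, ?_, Set.union_compl_self P, ?_,
    Set.inter_compl_self P⟩, p, ?_⟩
  · rw [Set.eq_univ_iff_forall]
    intro v
    obtain ⟨x, rfl⟩ := exists_vertexAt h0 v
    by_cases hx : x.1 ∈ P
    · exact Or.inl ⟨x.1, hx, x.2.1, G.vertexAt_eq x⟩
    · exact Or.inr ⟨x.1, hx, x.2.1, G.vertexAt_eq x⟩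
  · apply Set.Subset.antisymm
    · rintro v ⟨⟨e, he, i, rfl⟩, e', he', i', hv⟩
      have key := mem_of_vertexAt_eq (G := G) (Z := {z | G.vertexAt z = G.vertexAt p ∨ z.1 ∈ P})
        (x := (e, i, false)) (y := (e', i', false)) ?_ ?_ hv (Or.inr he)
      · rcases key with hk | hk
        · exact hv.trans hk
        · exact (he' hk).elim
      · rintro x (hx | hx)
        · exact Or.inl ((G.vertexAt_arc x).trans hx)
        · by_cases hx' : (G.arc x).1 ∈ P
          · exact Or.inr hx'
          · exact Or.inl ((G.vertexAt_arc x).trans (hw x hx hx'))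
      · rintro x (hx | hx)
        · exact Or.inl ((G.vertexAt_acrossEnd x).trans hx)
        · exact Or.inr hx
    · rintro v rfl
      refine ⟨⟨p.1, hp, p.2.1, G.vertexAt_eq p⟩, _, hp', (G.arc p).2.1, ?_⟩
      rw [← vertexAt_eq, vertexAt_arc]
  -- The boundary walk from `p` is periodic, and the corner just before `p` lies across the edge end
  -- from `G.arc p`, outside `P`.
  · have hex : ∃ k, (G.next^[k] p).1 ∉ P := by
      obtain ⟨m, hm, hper⟩ := (G.next_injective.mem_periodicPts p)
      obtain ⟨k, rfl⟩ := Nat.exists_eq_succ_of_ne_zero hm.ne'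
      refine ⟨k, ?_⟩
      have h1 : G.next (acrossEnd (G.arc p)) = p := by
        rw [next, acrossEnd_acrossEnd, G.arc_arc]
      have h2 : G.next (G.next^[k] p) = p := by
        rw [← Function.iterate_succ_apply' G.next]
        exact hper
      rw [G.next_injective (h2.trans h1.symm)]
      exact hp'
    have hmin : ∀ k < Nat.find hex, (G.next^[k] p).1 ∈ P := fun k hk =>
      not_not.1 (Nat.find_min hex hk)
    have hpos : 0 < Nat.find hex := Nat.pos_of_ne_zero fun h1 => by
      have := Nat.find_spec hex
      rw [h1] at this
      exact this hp
    -- The edge ends met before the walk first leaves `P`; they form the arc of the join.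
    let T : Set (Corner E) := {y | ∃ k < Nat.find hex,
      y = G.next^[k] p ∨ y = acrossEnd (G.next^[k] p)}
    have hTP : ∀ y ∈ T, y.1 ∈ P := by
      rintro y ⟨k, hk, rfl | rfl⟩
      · exact hmin k hk
      · exact hmin k hk
    have htip : ∀ y ∈ T, acrossEnd y ∈ T := by
      rintro y ⟨k, hk, rfl | rfl⟩
      · exact ⟨k, hk, Or.inr rfl⟩
      · exact ⟨k, hk, Or.inl (acrossEnd_acrossEnd _)⟩
    have hmixT : ∀ y ∈ T, G.arc y ∉ T → y = p ∨ y = q := by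
      rintro y ⟨k, hk, rfl | rfl⟩ hy
      · cases k with
        | zero => exact Or.inl rfl
        | succ k =>
          refine (hy ⟨k, Nat.lt_of_succ_lt hk, Or.inr ?_⟩).elim
          rw [Function.iterate_succ_apply', next, G.arc_arc]
      · have h1 : G.arc (acrossEnd (G.next^[k] p)) = G.next^[k + 1] p :=
          (Function.iterate_succ_apply' G.next k p).symm
        rw [h1] at hy
        have h2 : k + 1 = Nat.find hex := by
          by_contra h3
          exact hy ⟨k + 1, by omega, Or.inl rfl⟩
        refine (hmix _).1 ⟨hmin k hk, ?_⟩
        rw [h1, h2]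
        exact Nat.find_spec hex
    have hpT : p ∈ T := ⟨0, hpos, Or.inl rfl⟩
    have hqT : q ∈ T := mem_of_mixed_pair (S := G.flags) (p := p)
      (fun x => ⟨fun hx => by
        have := htip _ hx
        rwa [show G.flags.tip x = acrossEnd x from rfl, acrossEnd_acrossEnd] at this, htip x⟩)
      hmixT hpT fun hx => hp' (hTP _ hx)
    refine ⟨Nat.find hex, rfl, fun e he i hi => ?_, fun e he i => ?_⟩
    -- Both mixed corners `p` and `q` are in `T`, so `T` together with the corners outside `P` is
    -- closed along the vertex boundary and covers the whole vertex.
    · have key := mem_of_vertexAt_eq (G := G) (Z := {z | z ∈ T ∨ z.1 ∉ P})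
        (x := p) (y := (e, i, false)) ?_ ?_ hi.symm (Or.inl hpT)
      · obtain ⟨k, hk, h1 | h1⟩ := key.resolve_right (not_not.2 he)
        · exact ⟨k, hk, false, h1.symm⟩
        · refine ⟨k, hk, true, ?_⟩
          rw [← acrossEnd_acrossEnd (G.next^[k] p), ← h1]
          rfl
      · rintro x (hx | hx)
        · by_cases hx' : G.arc x ∈ T
          · exact Or.inl hx'
          · exact Or.inr ((hmix x).2 (hmixT x hx hx')).2
        · by_cases hx' : (G.arc x).1 ∈ P
          · rcases (hmix (G.arc x)).1 ⟨hx', by rwa [G.arc_arc]⟩ with h1 | h1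
            · exact Or.inl (h1 ▸ hpT)
            · exact Or.inl (h1 ▸ hqT)
          · exact Or.inr hx'
      · rintro x (hx | hx)
        · exact Or.inl (htip x hx)
        · exact Or.inr hx
    · rintro ⟨k, hk, b, h1⟩
      have := hmin k hk
      rw [h1] at this
      exact he this

end RibbonGraph

/-! ### Partial duals -/

namespace RibbonGraph

open Corner FlagSystem

variable {E : Type u} {E' : Type v}

theorem sideCorner_acrossEnd (x : Corner E) :
    sideCorner (acrossEnd x) = alongSide (sideCorner x) := by
  obtain ⟨e, i, b⟩ := x
  simp [sideCorner, acrossEnd, alongSide]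

theorem sideCorner_alongSide (x : Corner E) :
    sideCorner (alongSide x) = acrossEnd (sideCorner x) := by
  obtain ⟨e, i, b⟩ := x
  simp [sideCorner, acrossEnd, alongSide]

theorem partialCorner_of_mem {A : Set E} {x : Corner E} (h : x.1 ∈ A) :
    partialCorner A x = sideCorner x := if_pos h

theorem partialCorner_of_notMem {A : Set E} {x : Corner E} (h : x.1 ∉ A) :
    partialCorner A x = x := if_neg h

@[simp] theorem partialCorner_fst (A : Set E) (x : Corner E) : (partialCorner A x).1 = x.1 := by
  by_cases h : x.1 ∈ A
  · rw [partialCorner_of_mem h]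
    rfl
  · rw [partialCorner_of_notMem h]

theorem partialCorner_partialCorner_symmDiff (A B : Set E) (x : Corner E) :
    partialCorner A (partialCorner B x) = partialCorner (symmDiff A B) x := by
  by_cases hA : x.1 ∈ A <;> by_cases hB : x.1 ∈ B
  · have h : x.1 ∉ symmDiff A B := by simp [Set.mem_symmDiff, hA, hB]
    rw [partialCorner_of_mem hB, partialCorner_of_mem (x := sideCorner x) hA,
      partialCorner_of_notMem h, sideCorner_sideCorner]
  · have h : x.1 ∈ symmDiff A B := by simp [Set.mem_symmDiff, hA, hB]
    rw [partialCorner_of_notMem hB, partialCorner_of_mem hA, partialCorner_of_mem h]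
  · have h : x.1 ∈ symmDiff A B := by simp [Set.mem_symmDiff, hA, hB]
    rw [partialCorner_of_mem hB, partialCorner_of_notMem (x := sideCorner x) hA,
      partialCorner_of_mem h]
  · have h : x.1 ∉ symmDiff A B := by simp [Set.mem_symmDiff, hA, hB]
    rw [partialCorner_of_notMem hB, partialCorner_of_notMem hA, partialCorner_of_notMem h]

theorem eq_of_arc_eq {G H : RibbonGraph E} (h1 : ∀ x, G.arc x = H.arc x)
    (h2 : G.isolated = H.isolated) : G = H := by
  cases G
  cases H
  obtain rfl := funext h1
  obtain rfl := h2
  rfl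

theorem partialDual_partialDual (G : RibbonGraph E) (A B : Set E) :
    (G.partialDual A).partialDual B = G.partialDual (symmDiff A B) := by
  refine eq_of_arc_eq (fun x => ?_) rfl
  change partialCorner B (partialCorner A (G.arc (partialCorner A (partialCorner B x)))) = _
  rw [partialCorner_partialCorner_symmDiff, partialCorner_partialCorner_symmDiff,
    symmDiff_comm B A]
  rfl

theorem partialDual_empty (G : RibbonGraph E) : G.partialDual ∅ = G := by
  refine eq_of_arc_eq (fun x => ?_) rfl
  change partialCorner ∅ (G.arc (partialCorner ∅ x)) = _
  rw [partialCorner_of_notMem (Set.notMem_empty _), partialCorner_of_notMem (Set.notMem_empty _)]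

theorem partialDual_univ (G : RibbonGraph E) : G.partialDual Set.univ = G.dual := by
  refine eq_of_arc_eq (fun x => ?_) rfl
  change partialCorner _ (G.arc (partialCorner _ x)) = _
  rw [partialCorner_of_mem (Set.mem_univ _), partialCorner_of_mem (Set.mem_univ _)]
  rfl

/-- Conjugation by `partialCorner` turns `acrossEnd` into the involution defining the vertices of
the partial dual. -/
theorem partialCorner_acrossEnd (G : RibbonGraph E) (A : Set E) (x : Corner E) :
    partialCorner A (acrossEnd x) = G.flags.twist (corners A) (partialCorner A x) := by
  by_cases h : x.1 ∈ A
  · rw [twist_of_mem (S := G.flags) (A := corners A) (x := partialCorner A x)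
      (show (partialCorner A x).1 ∈ A by rwa [partialCorner_fst]), partialCorner_of_mem h,
      partialCorner_of_mem (x := acrossEnd x) h, sideCorner_acrossEnd]
    rfl
  · rw [twist_of_notMem (S := G.flags) (A := corners A) (x := partialCorner A x)
      (fun h' : (partialCorner A x).1 ∈ A => h (by rwa [partialCorner_fst] at h')), partialCorner_of_notMem h,
      partialCorner_of_notMem (x := acrossEnd x) h]
    rfl

theorem partialCorner_alongSide (G : RibbonGraph E) (A : Set E) (x : Corner E) :
    partialCorner A (alongSide x) = G.flags.twist (corners A)ᶜ (partialCorner A x) := by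
  by_cases h : x.1 ∈ A
  · rw [twist_of_notMem (S := G.flags) (A := (corners A)ᶜ) (x := partialCorner A x)
      (not_not.2 (show (partialCorner A x).1 ∈ A by rwa [partialCorner_fst])), partialCorner_of_mem h,
      partialCorner_of_mem (x := alongSide x) h, sideCorner_alongSide]
    rfl
  · rw [twist_of_mem (S := G.flags) (A := (corners A)ᶜ) (x := partialCorner A x)
      (fun h' : (partialCorner A x).1 ∈ A => h (by rwa [partialCorner_fst] at h')), partialCorner_of_notMem h,
      partialCorner_of_notMem (x := alongSide x) h]
    rfl

theorem partialCorner_arc (G : RibbonGraph E) (A : Set E) (x : Corner E) :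
    partialCorner A ((G.partialDual A).arc x) = G.arc (partialCorner A x) :=
  partialCorner_partialCorner A _

theorem finrank_invFun_inf_congr {X : Type*} (e : X ≃ X) {a c a' c' : X → X}
    (ha : ∀ x, e (a x) = a' (e x)) (hc : ∀ x, e (c x) = c' (e x)) :
    finrank (ZMod 2) ↥(invFun a ⊓ invFun c) = finrank (ZMod 2) ↥(invFun a' ⊓ invFun c') := by
  rw [← (LinearEquiv.funCongrLeft (ZMod 2) (ZMod 2) e).finrank_map_eq (invFun a' ⊓ invFun c')]
  have : (invFun a' ⊓ invFun c').map
      (LinearEquiv.funCongrLeft (ZMod 2) (ZMod 2) e : (X → ZMod 2) →ₗ[ZMod 2] X → ZMod 2) =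
      invFun a ⊓ invFun c := by
    ext f
    constructor
    · rintro ⟨g, ⟨h1, h2⟩, rfl⟩
      refine ⟨fun x => ?_, fun x => ?_⟩
      · change g (e (a x)) = g (e x)
        rw [ha, h1]
      · change g (e (c x)) = g (e x)
        rw [hc, h2]
    · rintro ⟨h1, h2⟩
      refine ⟨fun x => f (e.symm x), ⟨fun x => ?_, fun x => ?_⟩, funext fun x => ?_⟩
      · refine Eq.trans (congrArg f ?_) (h1 (e.symm x))
        rw [Equiv.symm_apply_eq, ha, Equiv.apply_symm_apply]
      · refine Eq.trans (congrArg f ?_) (h2 (e.symm x))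
        rw [Equiv.symm_apply_eq, hc, Equiv.apply_symm_apply]
      · exact congrArg f (e.symm_apply_apply x)
  rw [← this]

theorem twist_empty {X : Type*} (S : FlagSystem X) : S.twist ∅ = S.tip :=
  funext fun x => twist_of_notMem (Set.notMem_empty x)

theorem twist_univ {X : Type*} (S : FlagSystem X) : S.twist Set.univ = S.side :=
  funext fun x => twist_of_mem (Set.mem_univ x)

variable (G : RibbonGraph E) (A : Set E)

/-- Conjugation by `partialCorner A` carries the arcs of the partial dual to those of `G` and its
edge ends to `twist`. -/
theorem orbitRank_partialDual_empty :
    (G.partialDual A).flags.orbitRank ∅ = G.flags.orbitRank (corners A) := by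
  rw [orbitRank, twist_empty]
  exact finrank_invFun_inf_congr (Function.Involutive.toPerm _ (partialCorner_partialCorner A))
    (partialCorner_arc G A) (partialCorner_acrossEnd G A)

theorem orbitRank_partialDual_univ :
    (G.partialDual A).flags.orbitRank Set.univ = G.flags.orbitRank (corners A)ᶜ := by
  rw [orbitRank, twist_univ]
  exact finrank_invFun_inf_congr (Function.Involutive.toPerm _ (partialCorner_partialCorner A))
    (partialCorner_arc G A) (partialCorner_alongSide G A)

variable {G A}

theorem isConnected_partialDual (h : G.flags.IsConnected) :
    (G.partialDual A).flags.IsConnected := by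
  intro T h1 h2 h3
  have key : partialCorner A ⁻¹' T = Set.univ := by
    obtain ⟨B, rfl⟩ := exists_eq_corners h1
    have hB : partialCorner A ⁻¹' corners B = corners B := by
      ext x
      change (partialCorner A x).1 ∈ B ↔ _
      rw [partialCorner_fst]
      rfl
    rw [hB]
    refine h _ (isEdgeSet_corners G B) (fun x => ?_) h3
    have := h2 (partialCorner A x)
    change (partialCorner A (G.arc (partialCorner A (partialCorner A x)))).1 ∈ B ↔
      (partialCorner A x).1 ∈ B at this
    rwa [partialCorner_partialCorner, partialCorner_fst, partialCorner_fst] at this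
  rw [Set.eq_univ_iff_forall] at key ⊢
  intro x
  have := key (partialCorner A x)
  rwa [Set.mem_preimage, partialCorner_partialCorner] at this

/-- `partialCorner` moves corners only within their own edge, so the arcs still join the same edges.
-/
theorem card_mixed_partialDual (B : Set E) :
    Nat.card {x // x ∈ corners B ∧ (G.partialDual A).flags.arc x ∉ corners B} =
      Nat.card {x // x ∈ corners B ∧ G.flags.arc x ∉ corners B} := by
  have h : ∀ x, (G.partialDual A).flags.arc x ∈ corners B ↔
      G.flags.arc (partialCorner A x) ∈ corners B := fun x => by
    change (partialCorner A (G.arc (partialCorner A x))).1 ∈ B ↔ _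
    rw [partialCorner_fst]
    rfl
  refine Nat.card_congr (Equiv.subtypeEquiv
    (Function.Involutive.toPerm _ (partialCorner_partialCorner A)) fun x => ?_)
  rw [h]
  refine and_congr ?_ Iff.rfl
  change _ ↔ (partialCorner A x).1 ∈ B
  rw [partialCorner_fst]
  rfl

/-! ### Euler characteristic in terms of ranks -/

section Counting

theorem card_corner : Nat.card (Corner E) = 4 * Nat.card E := by
  rw [Nat.card_prod, Nat.card_prod, mul_comm]
  simp

variable [Finite E]

theorem finrank_side_inf_tip :
    finrank (ZMod 2) ↥(invFun G.flags.side ⊓ invFun G.flags.tip) = Nat.card E := by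
  have h := finrank_eq_card_quot (X := Corner E)
    (r := fun x y => y = alongSide x ∨ y = acrossEnd x)
    (U := invFun G.flags.side ⊓ invFun G.flags.tip) fun f => ⟨?_, fun h =>
      ⟨fun x => (h x _ (Or.inl rfl)).symm, fun x => (h x _ (Or.inr rfl)).symm⟩⟩
  · rw [h]
    refine Nat.card_congr
      { toFun := Quot.lift Prod.fst (by rintro x y (rfl | rfl) <;> rfl)
        invFun := fun e => Quot.mk _ (e, false, false)
        left_inv := fun q => ?_
        right_inv := fun e => rfl }
    obtain ⟨⟨e, i, b⟩, rfl⟩ := Quot.exists_rep q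
    have h1 : ∀ i b, Quot.mk (fun x y : Corner E => y = alongSide x ∨ y = acrossEnd x)
        (e, i, b) = Quot.mk _ (e, !i, !b) := fun i b => Quot.sound (Or.inl rfl)
    have h2 : ∀ i b, Quot.mk (fun x y : Corner E => y = alongSide x ∨ y = acrossEnd x)
        (e, i, b) = Quot.mk _ (e, i, !b) := fun i b => Quot.sound (Or.inr rfl)
    change Quot.mk _ (e, false, false) = Quot.mk _ (e, i, b)
    cases i <;> cases b
    · rfl
    · exact h2 false false
    · exact (h1 false false).trans (h2 true true)
    · exact h1 false false
  · rintro ⟨h1, h2⟩ x y (rfl | rfl)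
    · exact (h1 x).symm
    · exact (h2 x).symm

theorem card_quot_sum_fin {X : Type*} [Finite X] (r : X → X → Prop) (n : ℕ) :
    Nat.card (Quot r ⊕ Fin n) = Nat.card (Quot r) + n := by
  rw [Nat.card_sum, Nat.card_fin]

theorem card_vertex (G : RibbonGraph E) :
    Nat.card G.Vertex = G.flags.orbitRank ∅ + G.isolated := by
  rw [orbitRank, twist_empty, finrank_eq_card_quot (X := Corner E)
    (r := fun x y => y = G.arc x ∨ y = acrossEnd x)
    (U := invFun G.flags.arc ⊓ invFun G.flags.tip) fun f => ⟨?_, fun h =>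
      ⟨fun x => (h x _ (Or.inl rfl)).symm, fun x => (h x _ (Or.inr rfl)).symm⟩⟩]
  · exact card_quot_sum_fin _ _
  · rintro ⟨h1, h2⟩ x y (rfl | rfl)
    · exact (h1 x).symm
    · exact (h2 x).symm

theorem card_boundaryComponent (G : RibbonGraph E) :
    Nat.card G.BoundaryComponent = G.flags.orbitRank Set.univ + G.isolated := by
  rw [orbitRank, twist_univ, finrank_eq_card_quot (X := Corner E)
    (r := fun x y => y = G.arc x ∨ y = alongSide x)
    (U := invFun G.flags.arc ⊓ invFun G.flags.side) fun f => ⟨?_, fun h =>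
      ⟨fun x => (h x _ (Or.inl rfl)).symm, fun x => (h x _ (Or.inr rfl)).symm⟩⟩]
  · exact card_quot_sum_fin _ _
  · rintro ⟨h1, h2⟩ x y (rfl | rfl)
    · exact (h1 x).symm
    · exact (h2 x).symm

end Counting

/-! ### Invariance under equivalence -/

namespace Equivalent

theorem refl (G : RibbonGraph E) : G.Equivalent G :=
  ⟨rfl, Equiv.refl _, fun _ => rfl, fun _ => rfl, fun _ => rfl⟩

theorem trans {E'' : Type*} {G : RibbonGraph E} {H : RibbonGraph E'} {K : RibbonGraph E''}
    (h1 : G.Equivalent H) (h2 : H.Equivalent K) : G.Equivalent K := by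
  obtain ⟨i1, φ, a1, b1, c1⟩ := h1
  obtain ⟨i2, ψ, a2, b2, c2⟩ := h2
  exact ⟨i1.trans i2, φ.trans ψ, fun x => (congrArg ψ (a1 x)).trans (a2 _),
    fun x => (congrArg ψ (b1 x)).trans (b2 _), fun x => (congrArg ψ (c1 x)).trans (c2 _)⟩

/-- Partial duality commutes with equivalence. -/
theorem exists_partialDual {G : RibbonGraph E} {H : RibbonGraph E'} (h : G.Equivalent H)
    (B : Set E') : ∃ A : Set E, (G.partialDual A).Equivalent (H.partialDual B) := by
  obtain ⟨h0, φ, hacr, hal, harc⟩ := h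
  have hA : ∀ x : Corner E, (φ (x.1, false, false)).1 = (φ x).1 := by
    rintro ⟨e, i, b⟩
    have h1 : ∀ i b, (φ (e, i, !b)).1 = (φ (e, i, b)).1 := fun i b =>
      (congrArg (fun y : Corner E' => y.1) (hacr (e, i, b)) :)
    have h2 : ∀ i b, (φ (e, !i, !b)).1 = (φ (e, i, b)).1 := fun i b =>
      (congrArg (fun y : Corner E' => y.1) (hal (e, i, b)) :)
    cases i <;> cases b
    · rfl
    · exact (h1 false false).symm
    · exact (h2 false false).symm.trans (h1 true true).symm
    · exact (h2 false false).symm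
  -- By `hA`, `φ` maps all corners of an edge to one edge, so `B` can be pulled back.
  let A : Set E := {e | (φ (e, false, false)).1 ∈ B}
  have hmem : ∀ x : Corner E, x.1 ∈ A ↔ (φ x).1 ∈ B := fun x => by rw [← hA x]; rfl
  refine ⟨A, h0, (Function.Involutive.toPerm _ (partialCorner_partialCorner A)).trans
    (φ.trans (Function.Involutive.toPerm _ (partialCorner_partialCorner B))), ?_, ?_, ?_⟩
  · intro x
    change partialCorner B (φ (partialCorner A (acrossEnd x))) =
      acrossEnd (partialCorner B (φ (partialCorner A x)))
    by_cases hx : x.1 ∈ A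
    · have h1 : (φ (sideCorner x)).1 ∈ B := (hmem _).1 hx
      rw [partialCorner_of_mem hx, partialCorner_of_mem (x := acrossEnd x) hx,
        sideCorner_acrossEnd, hal, partialCorner_of_mem h1,
        partialCorner_of_mem (x := alongSide _) h1, sideCorner_alongSide]
    · have h1 : (φ x).1 ∉ B := fun h => hx ((hmem _).2 h)
      rw [partialCorner_of_notMem hx, partialCorner_of_notMem (x := acrossEnd x) hx, hacr,
        partialCorner_of_notMem h1, partialCorner_of_notMem (x := acrossEnd _) h1]
  · intro x
    change partialCorner B (φ (partialCorner A (alongSide x))) =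
      alongSide (partialCorner B (φ (partialCorner A x)))
    by_cases hx : x.1 ∈ A
    · have h1 : (φ (sideCorner x)).1 ∈ B := (hmem _).1 hx
      rw [partialCorner_of_mem hx, partialCorner_of_mem (x := alongSide x) hx,
        sideCorner_alongSide, hacr, partialCorner_of_mem h1,
        partialCorner_of_mem (x := acrossEnd _) h1, sideCorner_acrossEnd]
    · have h1 : (φ x).1 ∉ B := fun h => hx ((hmem _).2 h)
      rw [partialCorner_of_notMem hx, partialCorner_of_notMem (x := alongSide x) hx, hal,
        partialCorner_of_notMem h1, partialCorner_of_notMem (x := alongSide _) h1]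
  · intro x
    change partialCorner B (φ (partialCorner A (partialCorner A (G.arc (partialCorner A x))))) =
      partialCorner B (H.arc (partialCorner B (partialCorner B (φ (partialCorner A x)))))
    rw [partialCorner_partialCorner, partialCorner_partialCorner, harc]

theorem eulerChar_eq [Finite E] [Finite E'] {G : RibbonGraph E} {H : RibbonGraph E'}
    (h : G.Equivalent H) : G.eulerChar = H.eulerChar := by
  obtain ⟨h0, φ, hacr, hal, harc⟩ := h
  have hE : Nat.card E = Nat.card E' := by
    have := Nat.card_congr φ
    rw [card_corner, card_corner] at this
    omega
  have hV : Nat.card G.Vertex = Nat.card H.Vertex :=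
    Nat.card_congr (Equiv.sumCongr (Quot.congr φ fun x y => by
      rw [← harc, ← hacr, φ.apply_eq_iff_eq, φ.apply_eq_iff_eq]) (finCongr h0))
  have hF : Nat.card G.BoundaryComponent = Nat.card H.BoundaryComponent :=
    Nat.card_congr (Equiv.sumCongr (Quot.congr φ fun x y => by
      rw [← harc, ← hal, φ.apply_eq_iff_eq, φ.apply_eq_iff_eq]) (finCongr h0))
  rw [eulerChar, eulerChar, hE, hV, hF]

end Equivalent

theorem Connected.card_component (h : G.Connected) : Nat.card G.Component = 1 := by
  rw [Nat.card_eq_one_iff_unique]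
  obtain ⟨v, _⟩ := h.1
  refine ⟨⟨fun a b => ?_⟩, ⟨Quot.mk _ v⟩⟩
  obtain ⟨a, rfl⟩ := Quot.exists_rep a
  obtain ⟨b, rfl⟩ := Quot.exists_rep b
  have := h.2 a (Set.mem_univ _) b (Set.mem_univ _)
  induction this with
  | refl => rfl
  | tail _ h ih => exact ih.trans (Quot.sound h)

theorem Connected.eulerGenus_eq (h : G.Connected) : G.eulerGenus = 2 - G.eulerChar := by
  rw [eulerGenus, h.card_component]
  norm_num

/-! ### Moves, and induction on the number of mixed arcs -/

theorem DualJoinSummandMove.of_card_mixed [Finite E] (h0 : G.isolated = 0)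
    (h : G.flags.IsConnected) {Q : Set E}
    (hQ : Nat.card {x // x ∈ corners Q ∧ G.flags.arc x ∉ corners Q} = 2) :
    DualJoinSummandMove G (G.partialDual Q) := by
  -- A move dualizes the right summand, so `Qᶜ` must be the left one.
  rw [← card_mixed_compl, show (corners Q)ᶜ = corners Qᶜ from rfl] at hQ
  have := isJoin_of_card_mixed_eq_two h0 h hQ
  rw [compl_compl] at this
  exact ⟨_, _, this, Equivalent.refl _⟩

/-- By `hcl` every arc leaving `Q` is mixed for `A`. As `Q` lies on one side of `A`, moving it to
the other side makes these arcs unmixed and changes no other arc; the arc at `p` makes the drop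
strict. -/
theorem card_mixed_symmDiff_lt [Finite E] {Q : Set E}
    (hQA : corners Q ⊆ corners A ∨ corners Q ⊆ (corners A)ᶜ)
    (hcl : ∀ x ∈ corners Q, (G.flags.arc x ∈ corners A ↔ x ∈ corners A) →
      G.flags.arc x ∈ corners Q)
    {p : Corner E} (hp : p ∈ corners Q) (hp' : G.flags.arc p ∉ corners Q) :
    Nat.card {x // x ∈ corners (symmDiff Q A) ∧ G.flags.arc x ∉ corners (symmDiff Q A)} <
      Nat.card {x // x ∈ corners A ∧ G.flags.arc x ∉ corners A} := by
  change Set.ncard {x | x ∈ corners (symmDiff Q A) ∧ G.flags.arc x ∉ corners (symmDiff Q A)} <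
    Set.ncard {x | x ∈ corners A ∧ G.flags.arc x ∉ corners A}
  refine Set.ncard_lt_ncard ?_ (Set.toFinite _)
  have harc : ∀ x, G.flags.arc (G.flags.arc x) = x := G.flags.arc_invol
  have hs : ∀ x : Corner E, x ∈ corners (symmDiff Q A) ↔
      (x ∈ corners Q ∧ x ∉ corners A) ∨ (x ∈ corners A ∧ x ∉ corners Q) := fun x =>
    Set.mem_symmDiff
  have hpm : ¬ (G.flags.arc p ∈ corners A ↔ p ∈ corners A) := fun h => hp' (hcl p hp h)
  rcases hQA with hQA | hQA
  · refine ⟨fun x hx => ?_, fun hsub => ?_⟩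
    · have h1 := (hs x).1 hx.1
      have h2 := fun h => hx.2 ((hs _).2 h)
      have hxA : x ∈ corners A ∧ x ∉ corners Q := h1.resolve_left fun h => h.2 (hQA h.1)
      refine ⟨hxA.1, fun h3 => ?_⟩
      by_cases h4 : G.flags.arc x ∈ corners Q
      · have := hcl _ h4 (by rw [harc]; exact iff_of_true hxA.1 h3)
        rw [harc] at this
        exact hxA.2 this
      · exact h2 (Or.inr ⟨h3, h4⟩)
    · have h1 : p ∈ corners A := hQA hp
      have h2 : p ∈ corners (symmDiff Q A) := (hsub ⟨h1, fun h => hpm (iff_of_true h h1)⟩).1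
      rcases (hs p).1 h2 with h | h
      · exact h.2 h1
      · exact h.2 hp
  · refine ⟨fun x hx => ?_, fun hsub => ?_⟩
    · have h1 := (hs x).1 hx.1
      have h2 := fun h => hx.2 ((hs _).2 h)
      have h3 : G.flags.arc x ∉ corners A := fun h3 =>
        h2 (Or.inr ⟨h3, fun h4 => hQA h4 h3⟩)
      have h4 : G.flags.arc x ∉ corners Q := fun h4 => h2 (Or.inl ⟨h4, h3⟩)
      refine ⟨?_, h3⟩
      rcases h1 with h | h
      · exact (h4 (hcl x h.1 (iff_of_false h3 h.2))).elim
      · exact h.1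
    · have h1 : p ∉ corners A := hQA hp
      have h2 : G.flags.arc p ∈ corners A := by
        by_contra h2
        exact hpm (iff_of_false h2 h1)
      have h3 := (hsub (a := G.flags.arc p) ⟨h2, by rw [harc]; exact h1⟩).2
      rw [harc] at h3
      exact h3 ((hs p).2 (Or.inl ⟨hp, h1⟩))

/-- Partial duals of the same Euler genus, which is at most one, are reached by dualling
join-summands, unless all edges are dualized. -/
theorem reflTransGen_dualJoinSummandMove [Finite E] {c : ℕ} (hc : c = 1 ∨ c = 2) (N : ℕ) :
    ∀ (G : RibbonGraph E) (A : Set E), G.isolated = 0 → G.flags.IsConnected →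
      G.flags.orbitRank ∅ + G.flags.orbitRank Set.univ = Nat.card E + c →
      G.flags.orbitRank (corners A) + G.flags.orbitRank (corners A)ᶜ = Nat.card E + c →
      Nat.card {x // x ∈ corners A ∧ G.flags.arc x ∉ corners A} = N →
      Relation.ReflTransGen DualJoinSummandMove G (G.partialDual A) ∨ A = Set.univ := by
  induction N using Nat.strong_induction_on with
  | _ N ih =>
  intro G A h0 hconn h1 h2 hN
  rcases A.eq_empty_or_nonempty with rfl | hne
  · left
    rw [partialDual_empty]
  by_cases huniv : A = Set.univ
  · exact Or.inr huniv
  left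
  obtain ⟨e, he⟩ := hne
  obtain ⟨e', he'⟩ := (Set.ne_univ_iff_exists_notMem A).1 huniv
  have hlt := hconn.card_mixed_lt (isEdgeSet_corners G A) hc card_corner finrank_side_inf_tip h1 h2
  obtain ⟨Q', hQ', hsub, hcard, hcl⟩ := hconn.exists_piece (isEdgeSet_corners G A)
    ⟨(e, false, false), he⟩ ⟨(e', false, false), he'⟩ hlt
  obtain ⟨Q, rfl⟩ := exists_eq_corners hQ'
  obtain ⟨p, q, hpq, hmix⟩ := exists_pair_of_card_mixed hcard
  obtain ⟨hp, hp'⟩ := (hmix p).2 (Or.inl rfl)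
  have hdd : (G.partialDual Q).partialDual (symmDiff Q A) = G.partialDual A := by
    rw [partialDual_partialDual, symmDiff_symmDiff_cancel_left]
  have k1 : (G.partialDual Q).flags.orbitRank ∅ + (G.partialDual Q).flags.orbitRank Set.univ =
      Nat.card E + c := by
    rw [orbitRank_partialDual_empty, orbitRank_partialDual_univ,
      ← orbitRank_add_eq_of_card_eq_two hQ' hcard, h1]
  have k2 : (G.partialDual Q).flags.orbitRank (corners (symmDiff Q A)) +
      (G.partialDual Q).flags.orbitRank (corners (symmDiff Q A))ᶜ = Nat.card E + c := by
    rw [← orbitRank_partialDual_empty, ← orbitRank_partialDual_univ, hdd,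
      orbitRank_partialDual_empty, orbitRank_partialDual_univ, h2]
  rcases ih _ (hN ▸ card_mixed_symmDiff_lt hsub hcl hp hp') (G.partialDual Q) (symmDiff Q A) h0
    (isConnected_partialDual hconn) k1 k2 (card_mixed_partialDual _) with h | h
  · rw [hdd] at h
    exact Relation.ReflTransGen.head (DualJoinSummandMove.of_card_mixed h0 hconn hcard) h
  -- If everything remains to be dualized after `Q`, then `A` is the complementary summand, with the
  -- same two mixed arcs, and a single move from `G` reaches the goal.
  · have hA : A = Qᶜ := by
      rw [← symmDiff_symmDiff_cancel_left Q A, h]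
      ext x
      simp [Set.mem_symmDiff]
    rw [hA]
    refine Relation.ReflTransGen.single (DualJoinSummandMove.of_card_mixed h0 hconn ?_)
    exact (card_mixed_compl G.flags (corners Q)).trans hcard

theorem arePartialDuals_of_relatedByDualling {H : RibbonGraph E'} (h : G.RelatedByDualling H) :
    G.ArePartialDuals H := by
  rcases h with ⟨K, hK, hKH⟩ | h
  · have key : ∃ A : Set E, (G.partialDual A).Equivalent K := by
      clear hKH
      induction hK with
      | refl =>
        refine ⟨∅, ?_⟩
        rw [partialDual_empty]
        exact Equivalent.refl G
      | tail _ hmove ih =>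
        obtain ⟨A, hA⟩ := ih
        obtain ⟨P, Q, _, hQ⟩ := hmove
        -- The next move takes place in a graph only equivalent to a partial dual of `G`, so its
        -- edge set is pulled back to `E` before composing.
        obtain ⟨B, hB⟩ := hA.exists_partialDual Q.edges
        rw [partialDual_partialDual] at hB
        exact ⟨_, hB.trans hQ⟩
    obtain ⟨A, hA⟩ := key
    exact ⟨A, hA.trans hKH⟩
  · refine ⟨Set.univ, ?_⟩
    rwa [partialDual_univ]

theorem relatedByDualling_of_arePartialDuals [Finite E] [Finite E'] {H : RibbonGraph E'}
    (hG : G.Connected) (hH : H.Connected) {γ : ℤ} (hγ : γ = 0 ∨ γ = 1) (hGγ : G.eulerGenus = γ)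
    (hHγ : H.eulerGenus = γ) (h : G.ArePartialDuals H) : G.RelatedByDualling H := by
  obtain ⟨A, hA⟩ := h
  by_cases huniv : A = Set.univ
  · right
    rwa [← partialDual_univ, ← huniv]
  left
  -- An edge outside `A` excludes the one-vertex graph without edges, so there are no isolated
  -- vertices.
  obtain ⟨e, -⟩ := (Set.ne_univ_iff_exists_notMem A).1 huniv
  have hne : Nonempty E := ⟨e⟩
  have h0 := isolated_eq_zero_of_connected hG
  have h0' : (G.partialDual A).isolated = 0 := h0
  have hχ := hA.eulerChar_eq
  rw [hG.eulerGenus_eq, eulerChar, card_vertex, card_boundaryComponent, h0] at hGγ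
  rw [hH.eulerGenus_eq, ← hχ, eulerChar, card_vertex, card_boundaryComponent, h0',
    orbitRank_partialDual_empty, orbitRank_partialDual_univ] at hHγ
  obtain ⟨c, hc, hcγ⟩ : ∃ c : ℕ, (c = 1 ∨ c = 2) ∧ γ = 2 - c := by
    rcases hγ with rfl | rfl
    · exact ⟨2, Or.inr rfl, rfl⟩
    · exact ⟨1, Or.inl rfl, rfl⟩
  have := (reflTransGen_dualJoinSummandMove hc _ G A h0 (flags_isConnected_of_connected hG)
    (by omega) (by omega) rfl).resolve_right huniv
  exact ⟨_, this, hA⟩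

end RibbonGraph

theorem theorem5p6 {E : Type u} {E' : Type v} [Finite E] [Finite E']
    (G : RibbonGraph E) (H : RibbonGraph E') (hG : G.Connected) (hH : H.Connected) :
    (G.IsPlane ∧ H.IsPlane → (G.ArePartialDuals H ↔ G.RelatedByDualling H)) ∧
    (G.IsRP2 ∧ H.IsRP2 → (G.ArePartialDuals H ↔ G.RelatedByDualling H)) :=
  ⟨fun h => ⟨RibbonGraph.relatedByDualling_of_arePartialDuals hG hH (Or.inl rfl) h.1.2 h.2.2,
    RibbonGraph.arePartialDuals_of_relatedByDualling⟩,
  fun h => ⟨RibbonGraph.relatedByDualling_of_arePartialDuals hG hH (Or.inr rfl) h.1.2 h.2.2,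
    RibbonGraph.arePartialDuals_of_relatedByDualling⟩⟩
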